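/- Let $G$ be a (finite-dimensional) complex Lie group, $\Gamma\subset G$ a discrete subgroup with compact quotient, and let $M=\Gamma\backslash G$ be the resulting compact complex parallelizable manifold, with the complex structure for which the projection $\pi\colon G\to M$ is locally biholomorphic. Every left-invariant Hermitian metric on $G$ induces a unique Hermitian metric $g$ on $M$ whose pullback by $\pi$ is the given metric; call such metrics $g$ on $M$ left-invariant. For a Hermitian metric $g$ with complex structure $J$, let $F(X,Y)=g(JX,Y)$ be its Kähler form, $\delta$ the codifferential, $d^cF(A,B,C)=-dF(JA,JB,JC)$, and $D$ the Levi-Civita connection. The canonical Hermitian connections $\nabla^t$, $t\in\mathbb R$, are given by $$g(\nabla^t_AB,C)=g(D_AB,C)+\tfrac{t-1}{4}\,d^cF(A,B,C)+\tfrac{t+1}{4}\,d^cF(A,JB,JC).$$ With $R^t$ the curvature of $\nabla^t$, the Ricci form of $\nabla^t$ is $\rho^t(X,Y)=\sum_i g(R^t(X,Y)E_i,JE_i)$, where $(E_i)$ is a $g$-orthonormal frame. The metric $g$ is called balanced if $\delta F=0$, and CYT (Calabi–Yau with torsion) if the Ricci form $\rho^{-1}$ of the Bismut (KT) connection $\nabla^{-1}$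 vanishes. Theorem. Every left-invariant Hermitian metric $g$ on $M=\Gamma\backslash G$ is balanced and CYT. Moreover, the Ricci forms of all its canonical Hermitian connections vanish: $\rho^t=0$ for every $t\in\mathbb R$. -/

import Mathlib

open scoped Manifold ContDiff Topology

noncomputable section

/-! ### The complex manifold `Γ \ G` -/

/-- The quotient `Γ \ G`, i.e. the set of cosets `Γ a`, for a subgroup `Γ` of `G`. -/
def LeftQuotient {G : Type*} [Group G] (Γ : Subgroup G) : Type _ :=
  Quotient (QuotientGroup.rightRel Γ)

namespace LeftQuotient

/-- The projection `G → Γ \ G`. -/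
def proj {G : Type*} [Group G] (Γ : Subgroup G) (a : G) : LeftQuotient Γ :=
  Quotient.mk (QuotientGroup.rightRel Γ) a

theorem proj_eq_iff {G : Type*} [Group G] {Γ : Subgroup G} {a b : G} :
    proj Γ a = proj Γ b ↔ b * a⁻¹ ∈ Γ :=
  Quotient.eq''.trans QuotientGroup.rightRel_apply

/-- The quotient topology. -/
instance {G : Type*} [Group G] [TopologicalSpace G] (Γ : Subgroup G) :
    TopologicalSpace (LeftQuotient Γ) :=
  inferInstanceAs (TopologicalSpace (Quotient (QuotientGroup.rightRel Γ)))

theorem isLocalHomeomorph_proj {G : Type*} [Group G] [TopologicalSpace G] [IsTopologicalGroup G]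
    (Γ : Subgroup G) [DiscreteTopology Γ] : IsLocalHomeomorph (proj Γ) := by
  have h : Topology.IsQuotientMap (proj Γ) := isQuotientMap_quotient_mk'
  have h2 := h.isQuotientCoveringMap_of_subgroup Γ (isDiscrete_iff_discreteTopology.2 inferInstance)
    proj_eq_iff
  exact h2.isCoveringMap.isLocalHomeomorph

variable {E : Type*} [NormedAddCommGroup E] [NormedSpace ℂ E]
  {G : Type*} [Group G] [TopologicalSpace G] [ChartedSpace E G] [LieGroup 𝓘(ℂ, E) ω G]

variable (E) in
/-- The restriction of the projection `G → Γ \ G` to some open neighbourhood of `a`,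
on which it is a homeomorphism onto an open set. -/
def localProj (Γ : Subgroup G) [DiscreteTopology Γ] (a : G) :
    OpenPartialHomeomorph G (LeftQuotient Γ) :=
  haveI : IsTopologicalGroup G := topologicalGroup_of_lieGroup 𝓘(ℂ, E) ω
  (isLocalHomeomorph_proj Γ a).choose

theorem mem_localProj_source (Γ : Subgroup G) [DiscreteTopology Γ] (a : G) :
    a ∈ (localProj E Γ a).source :=
  haveI : IsTopologicalGroup G := topologicalGroup_of_lieGroup 𝓘(ℂ, E) ω
  (isLocalHomeomorph_proj Γ a).choose_spec.1

theorem coe_localProj (Γ : Subgroup G) [DiscreteTopology Γ] (a : G) :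
    ⇑(localProj E Γ a) = proj Γ :=
  haveI : IsTopologicalGroup G := topologicalGroup_of_lieGroup 𝓘(ℂ, E) ω
  (isLocalHomeomorph_proj Γ a).choose_spec.2.symm

/-- The charts of `Γ \ G` are the charts of `G` composed with local inverses of the projection. -/
instance chartedSpace (Γ : Subgroup G) [DiscreteTopology Γ] :
    ChartedSpace E (LeftQuotient Γ) where
  atlas := Set.range fun a : G => (localProj E Γ a).symm.trans (chartAt E a)
  chartAt x := (localProj E Γ (Quotient.out x)).symm.trans (chartAt E (Quotient.out x : G))
  mem_chart_source x := by
    have hx : proj Γ (Quotient.out x) = x := Quotient.out_eq x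
    have h1 := mem_localProj_source (E := E) Γ (Quotient.out x)
    have h2 := (localProj E Γ (Quotient.out x)).map_source h1
    have h3 := (localProj E Γ (Quotient.out x)).left_inv h1
    rw [coe_localProj, hx] at h2 h3
    simp only [OpenPartialHomeomorph.trans_source, OpenPartialHomeomorph.symm_source,
      Set.mem_inter_iff, Set.mem_preimage]
    refine ⟨h2, ?_⟩
    rw [h3]
    exact mem_chart_source E _
  chart_mem_atlas x := ⟨_, rfl⟩

/-- Local inverses of the projection differ locally by left translations. -/
theorem localProj_symm_eventuallyEq (Γ : Subgroup G) [DiscreteTopology Γ] (a p : G)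
    (hp : proj Γ p ∈ (localProj E Γ a).target) :
    ∃ γ : G, ∀ᶠ q in 𝓝 p, (localProj E Γ a).symm (proj Γ q) = γ * q := by
  have : IsTopologicalGroup G := topologicalGroup_of_lieGroup 𝓘(ℂ, E) ω
  set φ := localProj E Γ a with hφ
  have h1 : φ.symm (proj Γ p) ∈ φ.source := φ.map_target hp
  have h2 : proj Γ (φ.symm (proj Γ p)) = proj Γ p := by
    have := φ.right_inv hp
    rwa [hφ, coe_localProj, ← hφ] at this
  refine ⟨φ.symm (proj Γ p) * p⁻¹, ?_⟩
  have hc : Continuous fun q : G => φ.symm (proj Γ p) * p⁻¹ * q := by fun_prop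
  have h3 : ∀ᶠ q in 𝓝 p, φ.symm (proj Γ p) * p⁻¹ * q ∈ φ.source :=
    hc.continuousAt.eventually_mem (φ.open_source.mem_nhds (by simpa using h1))
  filter_upwards [h3] with q hq
  have h4 : proj Γ (φ.symm (proj Γ p) * p⁻¹ * q) = proj Γ q := by
    rw [eq_comm, proj_eq_iff]
    have := proj_eq_iff.1 h2.symm
    simpa [mul_assoc] using this
  have h5 := φ.left_inv hq
  rw [hφ, coe_localProj, ← hφ, h4] at h5
  exact h5

/-- `Γ \ G` is a complex manifold. -/
instance isManifold (Γ : Subgroup G) [DiscreteTopology Γ] :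
    IsManifold 𝓘(ℂ, E) ω (LeftQuotient Γ) := by
  apply isManifold_of_contDiffOn
  rintro _ _ ⟨a, rfl⟩ ⟨b, rfl⟩
  intro y hy
  apply ContDiffAt.contDiffWithinAt
  simp only [modelWithCornersSelf_coe, modelWithCornersSelf_coe_symm, Set.preimage_id,
    Set.range_id, Set.inter_univ, coe_localProj, mfld_simps] at hy ⊢
  obtain ⟨⟨hy1, -⟩, hy2, hy3⟩ := hy
  obtain ⟨γ, hγ⟩ := localProj_symm_eventuallyEq Γ b _ hy2
  have hs : ContMDiffAt 𝓘(ℂ, E) 𝓘(ℂ, E) ω (chartAt E a).symm y :=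
    (contMDiffOn_chart_symm (I := 𝓘(ℂ, E)) (x := a)).contMDiffAt
      ((chartAt E a).open_target.mem_nhds hy1)
  have hq := hγ.self_of_nhds
  have hm : ContMDiffAt 𝓘(ℂ, E) 𝓘(ℂ, E) ω (fun z => γ * (chartAt E a).symm z) y :=
    contMDiffAt_const.mul hs
  have hc : ContMDiffAt 𝓘(ℂ, E) 𝓘(ℂ, E) ω (chartAt E b) (γ * (chartAt E a).symm y) :=
    (contMDiffOn_chart (I := 𝓘(ℂ, E)) (x := b)).contMDiffAt
      ((chartAt E b).open_source.mem_nhds (by rw [← hq]; exact hy3))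
  refine (ContMDiffAt.comp y hc hm).contDiffAt.congr_of_eventuallyEq ?_
  filter_upwards [hs.continuousAt.eventually hγ] with z hz
  simp only [Function.comp_apply, hz]

/-- The projection `G → Γ \ G` is locally biholomorphic. -/
theorem isLocalDiffeomorph_proj (Γ : Subgroup G) [DiscreteTopology Γ] :
    IsLocalDiffeomorph 𝓘(ℂ, E) 𝓘(ℂ, E) ω (proj Γ) := by
  have key (o p : G) (hp : proj Γ p ∈ (localProj E Γ o).target) :
      ContMDiffAt 𝓘(ℂ, E) 𝓘(ℂ, E) ω (fun q => (localProj E Γ o).symm (proj Γ q)) p := by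
    obtain ⟨γ, hγ⟩ := localProj_symm_eventuallyEq Γ o p hp
    exact (contMDiffAt_const.mul contMDiffAt_id).congr_of_eventuallyEq hγ
  intro a
  refine ⟨⟨(localProj E Γ a).toPartialEquiv, (localProj E Γ a).open_source,
    (localProj E Γ a).open_target, ?_, ?_⟩, mem_localProj_source Γ a, ?_⟩
  · intro p _
    change ContMDiffWithinAt _ _ _ (localProj E Γ a) _ p
    rw [coe_localProj]
    apply ContMDiffAt.contMDiffWithinAt
    have hx := mem_chart_source E (proj Γ p)
    set c := chartAt E (proj Γ p) with hc
    have hx' := hx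
    change _ ∈ ((localProj E Γ (Quotient.out (proj Γ p))).symm.trans
      (chartAt E (Quotient.out (proj Γ p) : G))).source at hx'
    simp only [mfld_simps] at hx'
    have h1 := key _ p hx'.1
    have h2 : ContMDiffAt 𝓘(ℂ, E) 𝓘(ℂ, E) ω (fun q => c (proj Γ q)) p :=
      ContMDiffAt.comp p (g := chartAt E (Quotient.out (proj Γ p) : G))
        (f := fun q => (localProj E Γ (Quotient.out (proj Γ p))).symm (proj Γ q))
        ((contMDiffOn_chart (I := 𝓘(ℂ, E))
        (x := (Quotient.out (proj Γ p) : G))).contMDiffAt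
          ((chartAt E _).open_source.mem_nhds hx'.2)) h1
    have h3 : ContMDiffAt 𝓘(ℂ, E) 𝓘(ℂ, E) ω c.symm (c (proj Γ p)) :=
      (contMDiffOn_chart_symm (I := 𝓘(ℂ, E)) (x := proj Γ p)).contMDiffAt
        (c.open_target.mem_nhds (c.map_source hx))
    refine (ContMDiffAt.comp p h3 h2).congr_of_eventuallyEq ?_
    have hcont : Continuous (proj Γ) := continuous_quot_mk
    filter_upwards [hcont.continuousAt.eventually_mem (c.open_source.mem_nhds hx)] with q hq
    exact (c.left_inv hq).symm
  · intro x hx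
    apply ContMDiffAt.contMDiffWithinAt
    change ContMDiffAt _ _ _ (localProj E Γ a).symm x
    have hxc := mem_chart_source E x
    set o : G := Quotient.out x with ho
    have hx' := hxc
    change _ ∈ ((localProj E Γ o).symm.trans (chartAt E o)).source at hx'
    simp only [mfld_simps] at hx'
    set c := chartAt E x with hc
    have hpo : proj Γ o = x := Quotient.out_eq x
    have hoo : (localProj E Γ o).symm x = o := by
      have := (localProj E Γ o).left_inv (mem_localProj_source Γ o)
      rwa [coe_localProj, hpo] at this
    have h1 := key a o (by rw [hpo]; exact hx)
    have hc1 : ContMDiffAt 𝓘(ℂ, E) 𝓘(ℂ, E) ω c x :=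
      (contMDiffOn_chart (I := 𝓘(ℂ, E)) (x := x)).contMDiffAt (c.open_source.mem_nhds hxc)
    have hcx : c x = chartAt E o o := by
      change chartAt E o ((localProj E Γ o).symm x) = _
      rw [hoo]
    have h2 : ContMDiffAt 𝓘(ℂ, E) 𝓘(ℂ, E) ω (chartAt E o).symm (c x) :=
      (contMDiffOn_chart_symm (I := 𝓘(ℂ, E)) (x := o)).contMDiffAt
        ((chartAt E o).open_target.mem_nhds (by
          rw [hcx]; exact (chartAt E o).map_source (mem_chart_source E o)))
    have h3 : ContMDiffAt 𝓘(ℂ, E) 𝓘(ℂ, E) ω (fun z => (chartAt E o).symm (c z)) x :=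
      ContMDiffAt.comp x h2 hc1
    have h4 : ContMDiffAt 𝓘(ℂ, E) 𝓘(ℂ, E) ω
        (fun z => (localProj E Γ a).symm (proj Γ ((chartAt E o).symm (c z)))) x := by
      refine ContMDiffAt.comp x (f := fun z => (chartAt E o).symm (c z))
        (g := fun q => (localProj E Γ a).symm (proj Γ q)) ?_ h3
      have : (chartAt E o).symm (c x) = o := by
        rw [hcx]; exact (chartAt E o).left_inv (mem_chart_source E o)
      rw [this]
      exact h1
    refine h4.congr_of_eventuallyEq ?_
    filter_upwards [c.open_source.mem_nhds hxc] with z hz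
    congr 1
    change z ∈ ((localProj E Γ o).symm.trans (chartAt E o)).source at hz
    simp only [mfld_simps] at hz
    have : (chartAt E o).symm (c z) = (localProj E Γ o).symm z :=
      (chartAt E o).left_inv hz.2
    rw [this]
    have h6 := (localProj E Γ o).right_inv hz.1
    rw [coe_localProj] at h6
    exact h6.symm
  · intro q _
    change _ = localProj E Γ a q
    rw [coe_localProj]

end LeftQuotient

/-! ### Hermitian geometry on an open subset of a complex vector space

Here `g` is a Hermitian metric on an open set of `E` (a field of real bilinear forms), `J` is
multiplication by the imaginary unit, and vector fields are functions `E → E`. -/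

namespace Hermitian

variable {E : Type*} [NormedAddCommGroup E] [NormedSpace ℂ E]

variable (E) in
/-- The complex structure of `E`. -/
def J : E →L[ℝ] E := (Complex.I • ContinuousLinearMap.id ℂ E).restrictScalars ℝ

/-- The Kähler form `F(A, B) = g(J A, B)`. -/
def kahlerForm (g : E → E →L[ℝ] E →L[ℝ] ℝ) (y : E) : E →L[ℝ] E →L[ℝ] ℝ :=
  (g y).comp (J E)

/-- The exterior derivative `dF(A, B, C) = A F(B, C) + B F(C, A) + C F(A, B)` (for constant
`A`, `B`, `C`) of the Kähler form, as a linear form in `C`. -/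
def dKahler (g : E → E →L[ℝ] E →L[ℝ] ℝ) (y A B : E) : E →L[ℝ] ℝ :=
  fderiv ℝ (kahlerForm g) y A B + (fderiv ℝ (kahlerForm g) y B).flip A +
    ((fderiv ℝ (kahlerForm g) y).flip A).flip B

/-- `d^c F = J d F`, where `J` acts on `n`-forms by `(J α)(X₁, …) = (-1)ⁿ α(J X₁, …)`, so that
`d^c F(A, B, C) = - dF(J A, J B, J C)`; as a linear form in `C`. -/
def dcKahler (g : E → E →L[ℝ] E →L[ℝ] ℝ) (y A B : E) : E →L[ℝ] ℝ :=
  -(dKahler g y (J E A) (J E B)).comp (J E)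

/-- The vector that represents a linear form with respect to `g y`. -/
def sharp (g : E → E →L[ℝ] E →L[ℝ] ℝ) (y : E) : (E →L[ℝ] ℝ) →L[ℝ] E :=
  ContinuousLinearMap.inverse (g y)

/-- The Levi-Civita connection `D_A B = dB(A) + Γ(A, B)`, with Christoffel symbols given by
`2 g(Γ(A, B), C) = A g(B, C) + B g(A, C) - C g(A, B)` (for constant `A`, `B`, `C`). -/
def leviCivita (g : E → E →L[ℝ] E →L[ℝ] ℝ) (A B : E → E) (y : E) : E :=
  fderiv ℝ B y (A y) + sharp g y ((1 / 2 : ℝ) •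
    (fderiv ℝ g y (A y) (B y) + fderiv ℝ g y (B y) (A y)
      - ((fderiv ℝ g y).flip (A y)).flip (B y)))

/-- The canonical connection `∇ᵗ`:
`g(∇ᵗ_A B, C) = g(D_A B, C) + (t-1)/4 d^c F(A, B, C) + (t+1)/4 d^c F(A, J B, J C)`. -/
def canonicalConnection (g : E → E →L[ℝ] E →L[ℝ] ℝ) (t : ℝ) (A B : E → E) (y : E) : E :=
  leviCivita g A B y + sharp g y
    (((t - 1) / 4) • dcKahler g y (A y) (B y) +
      ((t + 1) / 4) • (dcKahler g y (A y) (J E (B y))).comp (J E))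

/-- The curvature `Rᵗ(A, B) C = ∇ᵗ_A ∇ᵗ_B C - ∇ᵗ_B ∇ᵗ_A C - ∇ᵗ_[A, B] C`. -/
def curvature (g : E → E →L[ℝ] E →L[ℝ] ℝ) (t : ℝ) (A B C : E → E) (y : E) : E :=
  canonicalConnection g t A (canonicalConnection g t B C) y
    - canonicalConnection g t B (canonicalConnection g t A C) y
    - canonicalConnection g t (VectorField.lieBracket ℝ A B) C y

/-- `b` is a basis of `E` that is orthonormal for `g y`. -/
def IsOrthonormalAt (g : E → E →L[ℝ] E →L[ℝ] ℝ) (y : E)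
    (b : Module.Basis (Fin (Module.finrank ℝ E)) ℝ E) : Prop :=
  ∀ i j, g y (b i) (b j) = if i = j then 1 else 0

/-- The Ricci form `ρᵗ(X, Y) = ∑ᵢ g(Rᵗ(X, Y) Eᵢ, J Eᵢ)` of `∇ᵗ` at `y`, computed in the
orthonormal basis `b = (Eᵢ)`. -/
def ricciForm (g : E → E →L[ℝ] E →L[ℝ] ℝ) (t : ℝ) (y : E)
    (b : Module.Basis (Fin (Module.finrank ℝ E)) ℝ E) (X Y : E) : ℝ :=
  ∑ i, g y (curvature g t (fun _ => X) (fun _ => Y) (fun _ => b i) y) (J E (b i))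

/-- The covariant derivative `(D_X F)(A, B) = X F(A, B) - F(D_X A, B) - F(A, D_X B)` of the
Kähler form at `y`. -/
def covKahler (g : E → E →L[ℝ] E →L[ℝ] ℝ) (y X A B : E) : ℝ :=
  fderiv ℝ (kahlerForm g) y X A B
    - kahlerForm g y (leviCivita g (fun _ => X) (fun _ => A) y) B
    - kahlerForm g y A (leviCivita g (fun _ => X) (fun _ => B) y)

/-- The codifferential `δF(Y) = - ∑ᵢ (D_{Eᵢ} F)(Eᵢ, Y)` of the Kähler form at `y`, computed in
the orthonormal basis `b = (Eᵢ)`. -/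
def codiffKahler (g : E → E →L[ℝ] E →L[ℝ] ℝ) (y : E)
    (b : Module.Basis (Fin (Module.finrank ℝ E)) ℝ E) (Y : E) : ℝ :=
  -∑ i, covKahler g y (b i) (b i) Y

end Hermitian

/-! ### Hermitian metrics on complex manifolds -/

section Metric

variable (E : Type*) [NormedAddCommGroup E] [NormedSpace ℂ E]
  {M : Type*} [TopologicalSpace M] [ChartedSpace E M]

/-- The pullback `(u, v) ↦ h(df u, df v)` of a bilinear form `h` on the tangent space at `f x`
under the differential of `f` at `x`. (`TangentSpace 𝓘(ℂ, E) x` is by definition `E`, whose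
elements represent tangent vectors at `x` through the chart `chartAt E x`.) -/
def pullbackForm {N : Type*} [TopologicalSpace N] [ChartedSpace E N] (f : N → M) (x : N)
    (h : E →L[ℝ] E →L[ℝ] ℝ) : E →L[ℝ] E →L[ℝ] ℝ :=
  h.bilinearComp
    ((mfderiv 𝓘(ℂ, E) 𝓘(ℂ, E) f x : E →L[ℂ] E).restrictScalars ℝ)
    ((mfderiv 𝓘(ℂ, E) 𝓘(ℂ, E) f x : E →L[ℂ] E).restrictScalars ℝ)

variable (M) in
/-- A (smooth) Hermitian metric on a complex manifold `M` modelled on `E`: a smooth Riemannian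
metric that is invariant under the complex structure of the tangent spaces. The form `inner x`
lives on the tangent space `TangentSpace 𝓘(ℂ, E) x = E`; its complex structure is that of `E`,
as the charts are holomorphic. Smoothness means that the coefficients in every holomorphic
chart are smooth. -/
@[ext]
structure HermitianMetric where
  /-- The bilinear form on each tangent space. -/
  inner (x : M) : E →L[ℝ] E →L[ℝ] ℝ
  symm (x : M) (u v : E) : inner x u v = inner x v u
  pos (x : M) (u : E) (hu : u ≠ 0) : 0 < inner x u u
  hermitian (x : M) (u v : E) : inner x (Hermitian.J E u) (Hermitian.J E v) = inner x u v
  smooth (e : OpenPartialHomeomorph M E) (he : e ∈ IsManifold.maximalAtlas 𝓘(ℂ, E) ω M) :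
    ContDiffOn ℝ ∞ (fun y : E => pullbackForm E e.symm y (inner (e.symm y))) e.target

end Metric

namespace HermitianMetric

variable {E : Type*} [NormedAddCommGroup E] [NormedSpace ℂ E]
  {M : Type*} [TopologicalSpace M] [ChartedSpace E M]

/-- The expression of a Hermitian metric in a chart `e`, a field of bilinear forms on
`e.target`. -/
def inChart (h : HermitianMetric E M) (e : OpenPartialHomeomorph M E) (y : E) :
    E →L[ℝ] E →L[ℝ] ℝ :=
  pullbackForm E e.symm y (h.inner (e.symm y))

/-- The Ricci form `ρᵗ` of the canonical connection `∇ᵗ` vanishes identically on `M`. -/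
def RicciFormVanishes (h : HermitianMetric E M) (t : ℝ) : Prop :=
  ∀ e ∈ IsManifold.maximalAtlas 𝓘(ℂ, E) ω M, ∀ y ∈ e.target,
    ∀ b, Hermitian.IsOrthonormalAt (h.inChart e) y b →
      ∀ X Y : E, Hermitian.ricciForm (h.inChart e) t y b X Y = 0

/-- Calabi-Yau with torsion: the Ricci form of the KT (Bismut) connection `∇⁻¹` vanishes. -/
def IsCYT (h : HermitianMetric E M) : Prop :=
  h.RicciFormVanishes (-1)

/-- Balanced: `δF = 0`. -/
def IsBalanced (h : HermitianMetric E M) : Prop :=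
  ∀ e ∈ IsManifold.maximalAtlas 𝓘(ℂ, E) ω M, ∀ y ∈ e.target,
    ∀ b, Hermitian.IsOrthonormalAt (h.inChart e) y b →
      ∀ Y : E, Hermitian.codiffKahler (h.inChart e) y b Y = 0

/-- All left translations `b ↦ a * b` of the group are isometries. -/
def IsLeftInvariant {G : Type*} [Group G] [TopologicalSpace G] [ChartedSpace E G]
    (g : HermitianMetric E G) : Prop :=
  ∀ a b : G, pullbackForm E (fun c : G => a * c) b (g.inner (a * b)) = g.inner b

/-- `h` is the metric on `Γ \ G` induced by the metric `g` on `G`, i.e. the pullback of `h` under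
the projection `G → Γ \ G` is `g`. -/
def IsInducedBy {G : Type*} [Group G] [TopologicalSpace G] [ChartedSpace E G]
    [LieGroup 𝓘(ℂ, E) ω G] {Γ : Subgroup G} [DiscreteTopology Γ]
    (h : HermitianMetric E (LeftQuotient Γ)) (g : HermitianMetric E G) : Prop :=
  ∀ a : G, pullbackForm E (LeftQuotient.proj Γ) a (h.inner (LeftQuotient.proj Γ a)) = g.inner a

end HermitianMetric

end

/-!
The left-invariant coframe `P` of a complex Lie group satisfies `dP = -[P, P]`, and a left-invariant
metric has constant coefficients in it. In this coframe `∇ᵗ` is the flat connection with parallel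
left-invariant fields (the Chern connection, `t = 1`) plus `(t - 1) S`, where
`S_u = (ad_u^* - ad_u) / 2` commutes with `J`. Hence its curvature is
`(t - 1)² [S_X, S_Y] - (t - 1) S_[X, Y]`. The commutator drops out of the Ricci form because
`tr (J [S_X, S_Y]) = 0`, and `tr (J S_u) = -tr (ad (J u))`. The codifferential of the Kähler form is
also a trace of `ad`, so everything follows once `G` is shown to be unimodular.

Comparing how many `Γ`-translates of a compact fundamental set are needed to cover its right
translates shows that a Haar measure is bi-invariant. The right-invariant fields therefore have zero
divergence for it, as do the left-invariant ones; expanding one kind in terms of the other near the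
identity and integrating by parts gives `tr (ad u) = 0`.
-/

noncomputable section

namespace Hermitian

variable {E : Type*} [NormedAddCommGroup E] [NormedSpace ℂ E]
  {g : E → E →L[ℝ] E →L[ℝ] ℝ} {g₀ : E →L[ℝ] E →L[ℝ] ℝ} {β : E →L[ℝ] E →L[ℝ] E}
  {P : E → E →L[ℝ] E} {y : E}

theorem J_J (u : E) : J E (J E u) = -u := by
  change Complex.I • Complex.I • u = -u
  rw [smul_smul, Complex.I_mul_I, neg_one_smul]

theorem trace_eq_sum_of_orthonormal {ι : Type*} [Fintype ι] [DecidableEq ι]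
    (b : Module.Basis ι ℝ E) (hb : ∀ i j, g₀ (b i) (b j) = if i = j then 1 else 0)
    (T : E →ₗ[ℝ] E) : LinearMap.trace ℝ E T = ∑ i, g₀ (T (b i)) (b i) := by
  rw [LinearMap.trace_eq_matrix_trace ℝ b, Matrix.trace]
  refine Finset.sum_congr rfl fun i _ => ?_
  have hcoord : g₀ (∑ j, b.repr (T (b i)) j • b j) (b i) = b.repr (T (b i)) i := by
    simp only [map_sum, sum_apply, map_smul, smul_apply, hb]
    simp
  rw [Matrix.diag_apply, LinearMap.toMatrix_apply, ← hcoord, b.sum_repr]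

/-- A Hermitian inner product on `E`, given by its real part. -/
structure IsHermitianForm (g₀ : E →L[ℝ] E →L[ℝ] ℝ) : Prop where
  symm (u v : E) : g₀ u v = g₀ v u
  pos (u : E) (hu : u ≠ 0) : 0 < g₀ u u
  hermitian (u v : E) : g₀ (J E u) (J E v) = g₀ u v

namespace IsHermitianForm

theorem J_left (h₀ : IsHermitianForm g₀) (u v : E) : g₀ (J E u) v = -g₀ u (J E v) := by
  rw [← h₀.hermitian u (J E v), J_J, map_neg, neg_neg]

theorem ext_left (h₀ : IsHermitianForm g₀) {u v : E} (huv : ∀ w, g₀ u w = g₀ v w) : u = v := by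
  by_contra hne
  have hpos := h₀.pos (u - v) (sub_ne_zero.2 hne)
  rw [ContinuousLinearMap.map_sub₂, huv, sub_self] at hpos
  exact lt_irrefl _ hpos

theorem bilinearComp (h₀ : IsHermitianForm g₀) {Q : E →L[ℝ] E} (hQ : Function.Injective Q)
    (hJ : ∀ u, Q (J E u) = J E (Q u)) : IsHermitianForm (g₀.bilinearComp Q Q) where
  symm u v := h₀.symm _ _
  pos u hu := h₀.pos _ fun h => hu (hQ (h.trans (map_zero Q).symm))
  hermitian u v := by simp only [ContinuousLinearMap.bilinearComp_apply, hJ, h₀.hermitian]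

variable [FiniteDimensional ℝ E]

theorem isInvertible (h₀ : IsHermitianForm g₀) : g₀.IsInvertible := by
  have hinj : Function.Injective g₀.toLinearMap := fun u v huv =>
    h₀.ext_left fun w => congrArg (fun l : E →L[ℝ] ℝ => l w) huv
  have hdim : Module.finrank ℝ E = Module.finrank ℝ (E →L[ℝ] ℝ) := by
    rw [← (LinearMap.toContinuousLinearMap (E := E) (F' := ℝ)).finrank_eq]
    exact Subspace.dual_finrank_eq.symm
  exact ⟨(LinearEquiv.ofInjectiveOfFinrankEq g₀.toLinearMap hinj hdim).toContinuousLinearEquiv,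
    by ext; rfl⟩

theorem apply_inverse (h₀ : IsHermitianForm g₀) (l : E →L[ℝ] ℝ) :
    g₀ (ContinuousLinearMap.inverse g₀ l) = l := by
  obtain ⟨e, rfl⟩ := h₀.isInvertible
  rw [ContinuousLinearMap.inverse_equiv]
  exact e.apply_symm_apply l

end IsHermitianForm

/-- The adjoint of an endomorphism with respect to a nondegenerate symmetric form, as a linear
function of the endomorphism. -/
def adjointCLM (g₀ : E →L[ℝ] E →L[ℝ] ℝ) : (E →L[ℝ] E) →L[ℝ] E →L[ℝ] E :=
  (ContinuousLinearMap.compL ℝ E (E →L[ℝ] ℝ) E (ContinuousLinearMap.inverse g₀)).comp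
    (((ContinuousLinearMap.compL ℝ E (E →L[ℝ] ℝ) (E →L[ℝ] ℝ)).flip g₀).comp
      (ContinuousLinearMap.compL ℝ E E ℝ).flip)

/-- The negative of the `g₀`-skew part of the left multiplications of a product `β`,
`(a, b) ↦ (β(a, ·)^* b - β(a, b)) / 2`. Up to the factor `t - 1`, it is the difference of the
canonical connection `∇ᵗ` and the flat connection of a frame with structure constants `β`. -/
def skewPart (g₀ : E →L[ℝ] E →L[ℝ] ℝ) (β : E →L[ℝ] E →L[ℝ] E) : E →L[ℝ] E →L[ℝ] E :=
  (1 / 2 : ℝ) • ((adjointCLM g₀).comp β - β)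

namespace IsHermitianForm

variable [FiniteDimensional ℝ E]

theorem apply_adjointCLM (h₀ : IsHermitianForm g₀) (T : E →L[ℝ] E) (u v : E) :
    g₀ (adjointCLM g₀ T u) v = g₀ u (T v) :=
  DFunLike.congr_fun (h₀.apply_inverse ((g₀ u).comp T)) v

theorem apply_skewPart (h₀ : IsHermitianForm g₀) (β : E →L[ℝ] E →L[ℝ] E) (a b c : E) :
    g₀ (skewPart g₀ β a b) c = (1 / 2 : ℝ) * (g₀ b (β a c) - g₀ (β a b) c) := by
  simp only [skewPart, smul_apply, sub_apply, map_smul, map_sub, smul_eq_mul,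
    ContinuousLinearMap.comp_apply, h₀.apply_adjointCLM]

end IsHermitianForm

/-- An antisymmetric product on `E` that is bilinear over `ℂ`, such as the bracket of a complex Lie
algebra. The Jacobi identity is not part of the definition. -/
structure IsComplexBracket (β : E →L[ℝ] E →L[ℝ] E) : Prop where
  skew (u v : E) : -β v u = β u v
  map_J_right (u v : E) : β u (J E v) = J E (β u v)

/-- All left multiplications of the product `β` are trace-free. -/
def IsUnimodular (β : E →L[ℝ] E →L[ℝ] E) : Prop :=
  ∀ u, LinearMap.trace ℝ E (β u).toLinearMap = 0

namespace IsComplexBracket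

theorem map_J_left (hβ : IsComplexBracket β) (u v : E) : β (J E u) v = J E (β u v) := by
  rw [← hβ.skew, hβ.map_J_right, ← map_neg, hβ.skew]

theorem self_eq_zero (hβ : IsComplexBracket β) (u : E) : β u u = 0 :=
  have : IsAddTorsionFree E := .of_isTorsionFree ℝ E
  self_eq_neg.1 (hβ.skew u u).symm

variable [FiniteDimensional ℝ E]

theorem skewPart_J (hβ : IsComplexBracket β) (h₀ : IsHermitianForm g₀) (u v : E) :
    skewPart g₀ β u (J E v) = J E (skewPart g₀ β u v) := by
  refine h₀.ext_left fun w => ?_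
  simp only [h₀.apply_skewPart, h₀.J_left, hβ.map_J_right]
  ring

theorem trace_J_comp_lie_skewPart (hβ : IsComplexBracket β) (h₀ : IsHermitianForm g₀) (u v : E) :
    LinearMap.trace ℝ E
      ((J E).comp ⁅skewPart g₀ β u, skewPart g₀ β v⁆ : E →L[ℝ] E).toLinearMap = 0 := by
  let S (u : E) : Module.End ℝ E := (skewPart g₀ β u).toLinearMap
  let 𝒥 : Module.End ℝ E := (J E).toLinearMap
  have hSJ (u : E) : S u * 𝒥 = 𝒥 * S u := LinearMap.ext fun w => hβ.skewPart_J h₀ u w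
  change LinearMap.trace ℝ E (𝒥 * (S u * S v - S v * S u)) = 0
  rw [mul_sub, map_sub, ← mul_assoc 𝒥 (S u), LinearMap.trace_mul_comm ℝ (𝒥 * S u), ← mul_assoc,
    hSJ, mul_assoc, sub_self]

theorem trace_J_comp_skewPart (hβ : IsComplexBracket β) (h₀ : IsHermitianForm g₀) {ι : Type*}
    [Finite ι] [DecidableEq ι] (b : Module.Basis ι ℝ E)
    (hb : ∀ i j, g₀ (b i) (b j) = if i = j then 1 else 0) (u : E) :
    LinearMap.trace ℝ E ((J E).comp (skewPart g₀ β u)).toLinearMap =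
      -LinearMap.trace ℝ E (β (J E u)).toLinearMap := by
  have := Fintype.ofFinite ι
  simp only [trace_eq_sum_of_orthonormal b hb, ← Finset.sum_neg_distrib]
  refine Finset.sum_congr rfl fun i _ => ?_
  change g₀ (J E (skewPart g₀ β u (b i))) (b i) = -g₀ (β (J E u) (b i)) (b i)
  rw [h₀.J_left, h₀.apply_skewPart, hβ.map_J_right, hβ.map_J_left, h₀.J_left (β u (b i)),
    h₀.symm (b i) (J E _), h₀.J_left (β u (b i))]
  ring

end IsComplexBracket

/-- Near `y`, the metric `g` is the pullback of the constant form `g₀` under a `ℂ`-linear coframe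
`P`, and at `y` the coframe satisfies the Maurer-Cartan equation `dP(A, B) = -β(P A, P B)`. -/
structure IsMaurerCartanAt (g : E → E →L[ℝ] E →L[ℝ] ℝ) (g₀ : E →L[ℝ] E →L[ℝ] ℝ)
    (β : E →L[ℝ] E →L[ℝ] E) (P : E → E →L[ℝ] E) (y : E) : Prop where
  contDiffAt : ContDiffAt ℝ 2 P y
  isInvertible : (P y).IsInvertible
  map_J : ∀ᶠ z in 𝓝 y, ∀ u, P z (J E u) = J E (P z u)
  metric : ∀ᶠ z in 𝓝 y, g z = g₀.bilinearComp (P z) (P z)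
  maurerCartan (A B : E) : fderiv ℝ P y A B - fderiv ℝ P y B A = -β (P y A) (P y B)

namespace IsMaurerCartanAt

section Derivatives

variable (h : IsMaurerCartanAt g g₀ β P y)

include h

theorem map_J_self (u : E) : P y (J E u) = J E (P y u) := h.map_J.self_of_nhds u

theorem metric_apply (u v : E) : g y u v = g₀ (P y u) (P y v) := by
  rw [h.metric.self_of_nhds, ContinuousLinearMap.bilinearComp_apply]

theorem differentiableAt : DifferentiableAt ℝ P y := h.contDiffAt.differentiableAt (by norm_num)

theorem isHermitianForm (h₀ : IsHermitianForm g₀) : IsHermitianForm (g y) := by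
  rw [h.metric.self_of_nhds]
  exact h₀.bilinearComp h.isInvertible.injective h.map_J_self

theorem hasFDerivAt_apply (B : E) : HasFDerivAt (fun z => P z B) ((fderiv ℝ P y).flip B) y := by
  simpa using h.differentiableAt.hasFDerivAt.clm_apply (hasFDerivAt_const B y)

theorem fderiv_map_J (A B : E) : fderiv ℝ P y A (J E B) = J E (fderiv ℝ P y A B) := by
  have hJP : (fun z => P z (J E B)) =ᶠ[𝓝 y] J E ∘ fun z => P z B :=
    h.map_J.mono fun z hz => hz B
  have hderiv := (J E).hasFDerivAt.comp y (h.hasFDerivAt_apply B)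
  exact DFunLike.congr_fun
    ((h.hasFDerivAt_apply (J E B)).unique (hderiv.congr_of_eventuallyEq hJP)) A

theorem differentiableAt_metric : DifferentiableAt ℝ g y := by
  have hcomp : DifferentiableAt ℝ
      (fun z => ((ContinuousLinearMap.compL ℝ E E ℝ).flip (P z)).comp (g₀.comp (P z))) y :=
    ((ContinuousLinearMap.compL ℝ E E ℝ).flip.differentiableAt.comp y h.differentiableAt).clm_comp
      ((differentiableAt_const g₀).clm_comp h.differentiableAt)
  exact hcomp.congr_of_eventuallyEq h.metric

theorem fderiv_metric (A B C : E) : fderiv ℝ g y A B C =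
    g₀ (fderiv ℝ P y A B) (P y C) + g₀ (P y B) (fderiv ℝ P y A C) := by
  have hg := ((h.differentiableAt_metric.hasFDerivAt.clm_apply
    (hasFDerivAt_const B y)).clm_apply (hasFDerivAt_const C y))
  have hP := (g₀.hasFDerivAt.comp y (h.hasFDerivAt_apply B)).clm_apply (h.hasFDerivAt_apply C)
  have heq : (fun z => g z B C) =ᶠ[𝓝 y] fun z => (g₀ ∘ fun z => P z B) z (P z C) :=
    h.metric.mono fun z hz => by simp only [hz]; rfl
  have := DFunLike.congr_fun (hg.unique (hP.congr_of_eventuallyEq heq)) A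
  simpa [add_comm] using this

theorem fderiv_kahlerForm (A B C : E) : fderiv ℝ (kahlerForm g) y A B C =
    g₀ (J E (fderiv ℝ P y A B)) (P y C) + g₀ (J E (P y B)) (fderiv ℝ P y A C) := by
  have hF : HasFDerivAt (kahlerForm g) _ y :=
    h.differentiableAt_metric.hasFDerivAt.clm_comp (hasFDerivAt_const (J E) y)
  have hFg : fderiv ℝ (kahlerForm g) y A B C = fderiv ℝ g y A (J E B) C := by
    simp [hF.fderiv]
  rw [hFg, h.fderiv_metric, h.fderiv_map_J, h.map_J_self]

theorem dKahler_eq (h₀ : IsHermitianForm g₀) (A B C : E) : dKahler g y A B C =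
    -(g₀ (J E (β (P y A) (P y B))) (P y C) + g₀ (J E (β (P y B) (P y C))) (P y A)
      + g₀ (J E (β (P y C) (P y A))) (P y B)) := by
  have hmc (A B C : E) : g₀ (J E (fderiv ℝ P y A B)) (P y C)
      + g₀ (J E (P y C)) (fderiv ℝ P y B A) = -g₀ (J E (β (P y A) (P y B))) (P y C) := by
    rw [h₀.J_left (P y C), h₀.symm (P y C), ← sub_eq_add_neg, ← sub_apply,
      ← map_sub, ← map_sub, h.maurerCartan, map_neg, map_neg, neg_apply]
  simp only [dKahler, add_apply, ContinuousLinearMap.flip_apply, h.fderiv_kahlerForm]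
  linarith [hmc A B C, hmc B C A, hmc C A B]

theorem dcKahler_eq (h₀ : IsHermitianForm g₀) (hβ : IsComplexBracket β) (A B C : E) :
    dcKahler g y A B C =
      -(g₀ (β (P y A) (P y B)) (P y C) + g₀ (β (P y B) (P y C)) (P y A)
        + g₀ (β (P y C) (P y A)) (P y B)) := by
  simp only [dcKahler, neg_apply, ContinuousLinearMap.comp_apply, h.dKahler_eq h₀, h.map_J_self,
    hβ.map_J_left, hβ.map_J_right, J_J, map_neg, h₀.hermitian]
  ring

end Derivatives

section Connections

variable [FiniteDimensional ℝ E]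

theorem apply_sharp (h : IsMaurerCartanAt g g₀ β P y) (h₀ : IsHermitianForm g₀)
    (l : E →L[ℝ] ℝ) (C : E) : g₀ (P y (sharp g y l)) (P y C) = l C := by
  rw [← h.metric_apply, sharp, (h.isHermitianForm h₀).apply_inverse]

theorem leviCivita_eq (h : IsMaurerCartanAt g g₀ β P y) (h₀ : IsHermitianForm g₀)
    (A B : E → E) (C : E) :
    g₀ (P y (leviCivita g A B y)) (P y C) =
      g₀ (P y (fderiv ℝ B y (A y)) + fderiv ℝ P y (A y) (B y)) (P y C) + (1 / 2 : ℝ) *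
      (g₀ (β (P y (A y)) (P y (B y))) (P y C) - g₀ (P y (B y)) (β (P y (A y)) (P y C))
        - g₀ (P y (A y)) (β (P y (B y)) (P y C))) := by
  have hmc (u A B : E) : g₀ u (fderiv ℝ P y A B) - g₀ u (fderiv ℝ P y B A) =
      -g₀ u (β (P y A) (P y B)) := by
    rw [← map_sub, h.maurerCartan, map_neg]
  have hBAC := hmc (P y (B y)) (A y) C
  have hABC := hmc (P y (A y)) (B y) C
  have hCAB := hmc (P y C) (A y) (B y)
  simp only [leviCivita, map_add, add_apply, h.apply_sharp h₀]
  simp only [smul_apply, add_apply, sub_apply, ContinuousLinearMap.flip_apply, h.fderiv_metric,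
    smul_eq_mul]
  rw [h₀.symm (fderiv ℝ P y _ _) (P y C), h₀.symm (fderiv ℝ P y _ _) (P y C),
    h₀.symm (fderiv ℝ P y _ _) (P y (B y)), h₀.symm (β _ _) (P y C)]
  linarith

/-- In the coframe `P`, the Chern connection `∇¹` is the flat connection whose parallel frame is
dual to `P`. -/
theorem map_canonicalConnection (h : IsMaurerCartanAt g g₀ β P y) (h₀ : IsHermitianForm g₀)
    (hβ : IsComplexBracket β) (t : ℝ) (A B : E → E) :
    P y (canonicalConnection g t A B y) = P y (fderiv ℝ B y (A y)) + fderiv ℝ P y (A y) (B y)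
      + (t - 1) • skewPart g₀ β (P y (A y)) (P y (B y)) := by
  refine h₀.ext_left fun w => ?_
  obtain ⟨C, rfl⟩ := h.isInvertible.surjective w
  rw [canonicalConnection, map_add (P y), map_add g₀, add_apply, h.leviCivita_eq h₀,
    h.apply_sharp h₀]
  simp only [map_add, add_apply, map_smul, smul_apply, smul_eq_mul, h₀.apply_skewPart,
    ContinuousLinearMap.comp_apply, h.dcKahler_eq h₀ hβ, h.map_J_self, hβ.map_J_left,
    hβ.map_J_right, h₀.hermitian, J_J]
  rw [← hβ.skew (P y C) (P y (A y)), h₀.symm (P y (B y)), h₀.symm (P y (A y))]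
  simp only [map_neg, neg_apply]
  ring

end Connections

end IsMaurerCartanAt

end Hermitian

section MovingFrame

variable {E F F' : Type*} [NormedAddCommGroup E] [NormedSpace ℝ E] [NormedAddCommGroup F]
  [NormedSpace ℝ F] [NormedAddCommGroup F'] [NormedSpace ℝ F']
  {P : E → F →L[ℝ] F'} {V : E → F} {Q : E → F'} {y : E}

theorem differentiableAt_of_clm_apply_eventuallyEq [CompleteSpace F]
    (hP : DifferentiableAt ℝ P y) (hP' : (P y).IsInvertible) (hQ : DifferentiableAt ℝ Q y)
    (hPV : ∀ᶠ z in 𝓝 y, P z (V z) = Q z) : DifferentiableAt ℝ V y := by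
  obtain ⟨e, he⟩ := hP'
  have hinverse := (contDiffAt_map_inverse (n := 1) e).differentiableAt one_ne_zero
  rw [he] at hinverse
  have hinv : DifferentiableAt ℝ (fun z => ContinuousLinearMap.inverse (P z)) y :=
    hinverse.comp y hP
  refine (hinv.clm_apply hQ).congr_of_eventuallyEq ?_
  filter_upwards [hPV, hP.continuousAt.eventually_mem (he ▸ e.nhds)] with z hz ⟨e', he'⟩
  rw [← hz, ← he', ContinuousLinearMap.inverse_equiv]
  exact (e'.symm_apply_apply _).symm

theorem clm_apply_fderiv_of_eventuallyEq [CompleteSpace F]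
    (hP : DifferentiableAt ℝ P y) (hP' : (P y).IsInvertible) (hQ : DifferentiableAt ℝ Q y)
    (hPV : ∀ᶠ z in 𝓝 y, P z (V z) = Q z) (X : E) :
    P y (fderiv ℝ V y X) = fderiv ℝ Q y X - fderiv ℝ P y X (V y) := by
  have hV := differentiableAt_of_clm_apply_eventuallyEq hP hP' hQ hPV
  have := DFunLike.congr_fun ((hP.hasFDerivAt.clm_apply hV.hasFDerivAt).unique
    (hQ.hasFDerivAt.congr_of_eventuallyEq hPV)) X
  exact eq_sub_of_add_eq (by simpa using this)

end MovingFrame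

namespace Hermitian

variable {E : Type*} [NormedAddCommGroup E] [NormedSpace ℂ E]
  {g : E → E →L[ℝ] E →L[ℝ] ℝ} {g₀ : E →L[ℝ] E →L[ℝ] ℝ} {β : E →L[ℝ] E →L[ℝ] E}
  {P : E → E →L[ℝ] E} {y : E}

namespace IsMaurerCartanAt

theorem exists_orthonormal (h : IsMaurerCartanAt g g₀ β P y)
    {b : Module.Basis (Fin (Module.finrank ℝ E)) ℝ E} (hb : IsOrthonormalAt g y b) :
    ∃ c : Module.Basis (Fin (Module.finrank ℝ E)) ℝ E,
      (∀ i, P y (b i) = c i) ∧ ∀ i j, g₀ (c i) (c j) = if i = j then 1 else 0 := by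
  obtain ⟨e, he⟩ := h.isInvertible
  have hc (i) : P y (b i) = (b.map e.toLinearEquiv) i := by rw [← he]; simp
  refine ⟨b.map e.toLinearEquiv, hc, fun i j => ?_⟩
  rw [← hc, ← hc, ← h.metric_apply]
  exact hb i j

theorem hasFDerivAt_connection (h : IsMaurerCartanAt g g₀ β P y) (S : E →L[ℝ] E →L[ℝ] E) (s : ℝ)
    (Y C : E) :
    HasFDerivAt (fun z => fderiv ℝ P z Y C + s • S (P z Y) (P z C))
      (((fderiv ℝ (fderiv ℝ P) y).flip Y).flip C + s • ((S (P y Y)).comp ((fderiv ℝ P y).flip C) +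
        (S.comp ((fderiv ℝ P y).flip Y)).flip (P y C))) y := by
  have hP' : DifferentiableAt ℝ (fderiv ℝ P) y :=
    (h.contDiffAt.fderiv_right (m := 1) (by norm_num)).differentiableAt (by norm_num)
  have hd := (hP'.hasFDerivAt.clm_apply (hasFDerivAt_const Y y)).clm_apply (hasFDerivAt_const C y)
  have hS := (S.hasFDerivAt.comp y (h.hasFDerivAt_apply Y)).clm_apply (h.hasFDerivAt_apply C)
  refine (hd.add (hS.const_smul s)).congr_fderiv (ContinuousLinearMap.ext fun v => ?_)
  simp

variable [FiniteDimensional ℝ E]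

theorem covKahler_self_eq (h : IsMaurerCartanAt g g₀ β P y) (h₀ : IsHermitianForm g₀)
    (hβ : IsComplexBracket β) (X Y : E) :
    covKahler g y X X Y = g₀ (β (J E (P y Y)) (P y X)) (P y X) := by
  have hXX := h.leviCivita_eq h₀ (fun _ => X) (fun _ => X) (J E Y)
  have hXY := h.leviCivita_eq h₀ (fun _ => X) (fun _ => Y) (J E X)
  simp only [fderiv_fun_const, Pi.zero_apply, zero_apply, map_zero, zero_add, h.map_J_self,
    hβ.map_J_right, hβ.self_eq_zero] at hXX hXY
  simp only [covKahler, kahlerForm, ContinuousLinearMap.comp_apply, h.fderiv_kahlerForm,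
    h.metric_apply, h.map_J_self]
  rw [h₀.J_left (P y _) (P y Y), hXX, h₀.symm (J E (P y X)) (P y _), hXY,
    ← hβ.skew (P y X) (P y Y), h₀.J_left _ (P y Y), h₀.symm (J E (P y X)) (fderiv ℝ P y X Y),
    hβ.map_J_left]
  have hJ := h₀.J_left (β (P y Y) (P y X)) (P y X)
  simp only [map_neg, neg_apply]
  rw [h₀.symm (P y X) (J E _)]
  linarith

theorem codiffKahler_eq_zero (h : IsMaurerCartanAt g g₀ β P y) (h₀ : IsHermitianForm g₀)
    (hβ : IsComplexBracket β) (htr : IsUnimodular β)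
    {b : Module.Basis (Fin (Module.finrank ℝ E)) ℝ E} (hb : IsOrthonormalAt g y b) (Y : E) :
    codiffKahler g y b Y = 0 := by
  obtain ⟨c, hc, hcc⟩ := h.exists_orthonormal hb
  simp only [codiffKahler, h.covKahler_self_eq h₀ hβ, hc]
  rw [neg_eq_zero, ← htr (J E (P y Y)), trace_eq_sum_of_orthonormal c hcc]
  rfl

end IsMaurerCartanAt

variable [FiniteDimensional ℝ E]

theorem map_canonicalConnection_canonicalConnection (h : ∀ᶠ z in 𝓝 y, IsMaurerCartanAt g g₀ β P z)
    (h₀ : IsHermitianForm g₀) (hβ : IsComplexBracket β) (t : ℝ) (X Y C : E) :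
    P y (canonicalConnection g t (fun _ => X)
      (canonicalConnection g t (fun _ => Y) (fun _ => C)) y) =
      fderiv ℝ (fderiv ℝ P) y X Y C + (t - 1) • (skewPart g₀ β (P y Y) (fderiv ℝ P y X C) +
        skewPart g₀ β (fderiv ℝ P y X Y) (P y C)) + (t - 1) • skewPart g₀ β (P y X)
          (fderiv ℝ P y Y C + (t - 1) • skewPart g₀ β (P y Y) (P y C)) := by
  have hy := h.self_of_nhds
  have hV : ∀ᶠ z in 𝓝 y, P z (canonicalConnection g t (fun _ => Y) (fun _ => C) z) =
      fderiv ℝ P z Y C + (t - 1) • skewPart g₀ β (P z Y) (P z C) := by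
    filter_upwards [h] with z hz
    simp [hz.map_canonicalConnection h₀ hβ]
  have hQ := hy.hasFDerivAt_connection (skewPart g₀ β) (t - 1) Y C
  rw [hy.map_canonicalConnection h₀ hβ, clm_apply_fderiv_of_eventuallyEq hy.differentiableAt
    hy.isInvertible hQ.differentiableAt hV, sub_add_cancel, hQ.fderiv, hV.self_of_nhds]
  simp

theorem map_curvature (h : ∀ᶠ z in 𝓝 y, IsMaurerCartanAt g g₀ β P z)
    (h₀ : IsHermitianForm g₀) (hβ : IsComplexBracket β) (t : ℝ) (X Y C : E) :
    P y (curvature g t (fun _ => X) (fun _ => Y) (fun _ => C) y) =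
      ((t - 1) ^ 2 • ⁅skewPart g₀ β (P y X), skewPart g₀ β (P y Y)⁆
        - (t - 1) • skewPart g₀ β (β (P y X) (P y Y))) (P y C) := by
  have hy := h.self_of_nhds
  have hsymm : fderiv ℝ (fderiv ℝ P) y X Y = fderiv ℝ (fderiv ℝ P) y Y X :=
    (hy.contDiffAt.isSymmSndFDerivAt (by simp)).eq X Y
  have hbracket : P y (canonicalConnection g t
      (VectorField.lieBracket ℝ (fun _ => X) (fun _ => Y)) (fun _ => C) y) = 0 := by
    simp [hy.map_canonicalConnection h₀ hβ, VectorField.lieBracket]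
  have hmc : fderiv ℝ P y X Y = fderiv ℝ P y Y X - β (P y X) (P y Y) := by
    rw [sub_eq_add_neg, ← hy.maurerCartan, add_sub_cancel]
  rw [curvature, map_sub, map_sub, map_canonicalConnection_canonicalConnection h h₀ hβ,
    map_canonicalConnection_canonicalConnection h h₀ hβ, hbracket, hsymm, hmc]
  simp only [map_add, map_sub, map_smul, sub_apply, smul_apply, Ring.lie_def,
    mul_apply_eq_comp]
  module

theorem ricciForm_eq_zero (h : ∀ᶠ z in 𝓝 y, IsMaurerCartanAt g g₀ β P z)
    (h₀ : IsHermitianForm g₀) (hβ : IsComplexBracket β) (htr : IsUnimodular β) (t : ℝ)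
    {b : Module.Basis (Fin (Module.finrank ℝ E)) ℝ E} (hb : IsOrthonormalAt g y b) (X Y : E) :
    ricciForm g t y b X Y = 0 := by
  have hy := h.self_of_nhds
  obtain ⟨c, hc, hcc⟩ := hy.exists_orthonormal hb
  let R : E →L[ℝ] E := (t - 1) ^ 2 • ⁅skewPart g₀ β (P y X), skewPart g₀ β (P y Y)⁆
    - (t - 1) • skewPart g₀ β (β (P y X) (P y Y))
  have hR : LinearMap.trace ℝ E ((J E).comp R).toLinearMap = 0 := by
    simp only [R, ContinuousLinearMap.comp_sub, ContinuousLinearMap.comp_smul,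
      ContinuousLinearMap.toLinearMap_sub, ContinuousLinearMap.toLinearMap_smul, map_sub, map_smul,
      hβ.trace_J_comp_lie_skewPart h₀, hβ.trace_J_comp_skewPart h₀ c hcc, htr _]
    simp
  rw [ricciForm, ← neg_eq_zero, ← Finset.sum_neg_distrib, ← hR, trace_eq_sum_of_orthonormal c hcc]
  refine Finset.sum_congr rfl fun i _ => ?_
  rw [hy.metric_apply, map_curvature h h₀ hβ, hy.map_J_self, hc, ← h₀.J_left]
  rfl

end Hermitian

section UnimodularGroup

open MeasureTheory Measure

section Unimodular

variable {G : Type*} [Group G]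

open scoped Classical in
theorem measure_le_mul_of_forall_card_le [MeasurableSpace G] [MeasurableMul G] (μ : Measure G)
    [IsMulLeftInvariant μ] {A K : Set G} (hA : MeasurableSet A) (F : Finset G) {N : ℕ}
    (hAK : ∀ x ∈ A, ∃ γ ∈ F, γ * x ∈ K) (hN : ∀ x, (F.filter fun γ => γ⁻¹ * x ∈ A).card ≤ N) :
    μ A ≤ N * μ K := by
  have hcover : A ⊆ ⋃ γ ∈ F, (γ * ·) ⁻¹' ((γ⁻¹ * ·) ⁻¹' A ∩ K) := fun x hx => by
    obtain ⟨γ, hγ, hγx⟩ := hAK x hx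
    exact Set.mem_iUnion₂.2 ⟨γ, hγ, by simpa using hx, hγx⟩
  have hmeas (γ : G) : MeasurableSet ((γ⁻¹ * ·) ⁻¹' A) := hA.preimage (measurable_const_mul _)
  calc μ A ≤ ∑ γ ∈ F, μ ((γ * ·) ⁻¹' ((γ⁻¹ * ·) ⁻¹' A ∩ K)) :=
        (measure_mono hcover).trans (measure_biUnion_finset_le _ _)
    _ = ∑ γ ∈ F, ∫⁻ x in K, ((γ⁻¹ * ·) ⁻¹' A).indicator 1 x ∂μ := by
        refine Finset.sum_congr rfl fun γ _ => ?_
        rw [measure_preimage_mul, lintegral_indicator_one (hmeas γ), restrict_apply (hmeas γ)]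
    _ = ∫⁻ x in K, ∑ γ ∈ F, ((γ⁻¹ * ·) ⁻¹' A).indicator 1 x ∂μ :=
        (lintegral_finsetSum F fun γ _ => measurable_one.indicator (hmeas γ)).symm
    _ ≤ ∫⁻ _ in K, N ∂μ := by
        refine lintegral_mono fun x => ?_
        simp only [Set.indicator_apply, Pi.one_apply, Set.mem_preimage, Finset.sum_boole]
        exact_mod_cast hN x
    _ = N * μ K := by simp

variable [TopologicalSpace G] [IsTopologicalGroup G]

namespace LeftQuotient

theorem exists_isCompact_forall_exists_mul_mem [LocallyCompactSpace G] (Γ : Subgroup G)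
    [DiscreteTopology Γ] [CompactSpace (LeftQuotient Γ)] :
    ∃ K : Set G, IsCompact K ∧ (interior K).Nonempty ∧ ∀ x, ∃ γ ∈ Γ, γ * x ∈ K := by
  have hopen : IsOpenMap (proj Γ) := (isLocalHomeomorph_proj Γ).isOpenMap
  choose K hKc hK using fun a : G => exists_compact_mem_nhds a
  obtain ⟨t, ht⟩ := isCompact_univ.elim_finite_subcover (fun a : G => proj Γ '' interior (K a))
    (fun a => hopen _ isOpen_interior) (fun x _ => by
      obtain ⟨a, rfl⟩ := Quotient.exists_rep x
      exact Set.mem_iUnion.2 ⟨a, a, mem_interior_iff_mem_nhds.2 (hK a), rfl⟩)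
  have hsub : ⋃ a ∈ t, interior (K a) ⊆ interior (⋃ a ∈ t, K a) :=
    interior_maximal (Set.iUnion₂_mono fun a _ => interior_subset)
      (isOpen_biUnion fun a _ => isOpen_interior)
  have hlift (x : LeftQuotient Γ) : ∃ y ∈ ⋃ a ∈ t, interior (K a), proj Γ y = x := by
    obtain ⟨a, ha, y, hy, hyx⟩ := Set.mem_iUnion₂.1 (ht (Set.mem_univ x))
    exact ⟨y, Set.mem_biUnion ha hy, hyx⟩
  refine ⟨⋃ a ∈ t, K a, t.isCompact_biUnion fun a _ => hKc a, ?_, fun x => ?_⟩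
  · obtain ⟨y, hy, -⟩ := hlift (proj Γ 1)
    exact ⟨y, hsub hy⟩
  · obtain ⟨y, hy, hyx⟩ := hlift (proj Γ x)
    exact ⟨y * x⁻¹, proj_eq_iff.1 hyx.symm, by simpa using interior_subset (hsub hy)⟩

end LeftQuotient

variable [T2Space G]

theorem finite_subgroup_inter_of_isCompact (Γ : Subgroup G) [DiscreteTopology Γ] {C : Set G}
    (hC : IsCompact C) : ((Γ : Set G) ∩ C).Finite :=
  have hΓ : IsDiscrete (Γ : Set G) := isDiscrete_iff_discreteTopology.2 inferInstance
  (hC.inter_left Γ.isClosed_of_discrete).finite (hΓ.mono Set.inter_subset_left)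

theorem exists_forall_measure_preimage_mul_right_le [MeasurableSpace G] [BorelSpace G]
    (μ : Measure G) [IsMulLeftInvariant μ] (Γ : Subgroup G) [DiscreteTopology Γ]
    {K : Set G} (hK : IsCompact K) (hΓK : ∀ x, ∃ γ ∈ Γ, γ * x ∈ K) :
    ∃ N : ℕ, ∀ a : G, μ ((· * a) ⁻¹' K) ≤ N * μ K := by
  classical
  have hD := finite_subgroup_inter_of_isCompact Γ (hK.mul hK.inv)
  refine ⟨hD.toFinset.card, fun a => ?_⟩
  set A : Set G := (· * a) ⁻¹' K with hA
  have hAc : IsCompact A := (Homeomorph.mulRight a).isCompact_preimage.2 hK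
  have hF := finite_subgroup_inter_of_isCompact Γ (hK.mul hAc.inv)
  refine measure_le_mul_of_forall_card_le μ hAc.measurableSet hF.toFinset (fun x hx => ?_)
    fun x => ?_
  · obtain ⟨γ, hγ, hγx⟩ := hΓK x
    exact ⟨γ, hF.mem_toFinset.2 ⟨hγ, γ * x, hγx, x⁻¹, Set.inv_mem_inv.2 hx, by simp⟩, hγx⟩
  · rcases (hF.toFinset.filter fun γ => γ⁻¹ * x ∈ A).eq_empty_or_nonempty with h | ⟨δ, hδ⟩
    · exact (congrArg Finset.card h).trans_le (Nat.zero_le _)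
    refine Finset.card_le_card_of_injOn (fun γ => γ⁻¹ * δ) (fun γ hγ => ?_)
      fun γ _ γ' _ h => by simpa using h
    simp only [Finset.coe_filter, Finset.mem_filter, Set.Finite.mem_toFinset, hA,
      Set.mem_preimage, Set.mem_ofPred_eq] at hγ hδ
    rw [Set.Finite.coe_toFinset]
    exact ⟨Γ.mul_mem (Γ.inv_mem hγ.1.1) hδ.1.1, _, hγ.2, _, Set.inv_mem_inv.2 hδ.2,
      by simp [mul_assoc]⟩

variable [LocallyCompactSpace G]

theorem modularCharacter_eq_one_of_cocompact (Γ : Subgroup G) [DiscreteTopology Γ]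
    [CompactSpace (LeftQuotient Γ)] : modularCharacter (G := G) = 1 := by
  borelize G
  obtain ⟨K, hK, hKi, hΓK⟩ := LeftQuotient.exists_isCompact_forall_exists_mul_mem Γ
  obtain ⟨N, hN⟩ := exists_forall_measure_preimage_mul_right_le haar Γ hK hΓK
  have hle (b : G) : modularCharacter b ≤ N := by
    have hmap : map (· * b) haar K = modularCharacterFun b • haar K := by
      rw [modularCharacterFun_eq_haarScalarFactor haar]
      exact measure_isMulInvariant_eq_smul_of_isCompact_closure _ _ hK.closure
    have hNb := hN b
    rw [map_apply (measurable_mul_const b) hK.measurableSet] at hmap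
    rw [hmap, ENNReal.smul_def, smul_eq_mul, ENNReal.mul_le_mul_iff_left
      (measure_pos_of_nonempty_interior _ hKi).ne' hK.measure_lt_top.ne] at hNb
    exact_mod_cast hNb
  have hle_one (b : G) : modularCharacter b ≤ 1 := by
    by_contra! h
    obtain ⟨n, hn⟩ := pow_unbounded_of_one_lt (N : NNReal) h
    exact absurd hn (not_lt.2 (map_pow modularCharacter b n ▸ hle (b ^ n)))
  refine MonoidHom.ext fun a => le_antisymm (hle_one a) ?_
  calc (1 : NNReal) = modularCharacter a * modularCharacter a⁻¹ := by
        rw [← map_mul, mul_inv_cancel, map_one]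
    _ ≤ modularCharacter a := mul_le_of_le_one_right zero_le (hle_one _)

theorem isMulRightInvariant_of_cocompact [MeasurableSpace G] [BorelSpace G] (Γ : Subgroup G)
    [DiscreteTopology Γ] [CompactSpace (LeftQuotient Γ)] (μ : Measure G) [IsHaarMeasure μ]
    [Regular μ] : IsMulRightInvariant μ where
  map_mul_right_eq_self a := by
    have : Regular (map (· * a) μ) := Regular.map (Homeomorph.mulRight a)
    rw [isMulLeftInvariant_eq_smul_of_regular (map (· * a) μ) μ,
      ← modularCharacterFun_eq_haarScalarFactor]
    change modularCharacter a • μ = μ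
    rw [modularCharacter_eq_one_of_cocompact Γ, MonoidHom.one_apply, one_smul]

end Unimodular

section IntegrationByParts

variable {E : Type*} [NormedAddCommGroup E] [NormedSpace ℝ E] [FiniteDimensional ℝ E]
  {F : Type*} [NormedAddCommGroup F] [NormedSpace ℝ F]
  [MeasurableSpace E] [BorelSpace E] {ν : Measure E} [IsFiniteMeasure ν]

omit [NormedSpace ℝ F] [IsFiniteMeasure ν] in
theorem aestronglyMeasurable_of_continuousOn_of_ae_mem {K : Set E} (hK : IsCompact K)
    (hνK : ∀ᵐ y ∂ν, y ∈ K) {f : E → F} (hf : ContinuousOn f K) : AEStronglyMeasurable f ν :=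
  restrict_eq_self_of_ae_mem hνK ▸ hf.aestronglyMeasurable hK.measurableSet

theorem hasFDerivAt_integral_of_contDiffAt {E' : Type*} [NormedAddCommGroup E']
    [NormedSpace ℝ E'] {K : Set E} (hK : IsCompact K) (hνK : ∀ᵐ y ∂ν, y ∈ K) {H : E × E' → F}
    {z₀ : E'} (hH : ∀ y ∈ K, ContDiffAt ℝ 1 H (y, z₀)) :
    HasFDerivAt (fun z => ∫ y, H (y, z) ∂ν)
      (∫ y, (fderiv ℝ H (y, z₀)).comp (.inr ℝ E E') ∂ν) z₀ := by
  set D : E × E' → E' →L[ℝ] F := fun p => (fderiv ℝ H p).comp (.inr ℝ E E')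
  have hpair (z : E') (y : E) : ContinuousAt (fun y => (y, z)) y := by fun_prop
  have hD (y : E) (hy : y ∈ K) : ContinuousAt D (y, z₀) :=
    ((hH y hy).continuousAt_fderiv one_ne_zero).clm_comp continuousAt_const
  have hDcont : ContinuousOn (fun y => D (y, z₀)) K := fun y hy =>
    ((hD y hy).comp (f := fun y => (y, z₀)) (hpair z₀ y)).continuousWithinAt
  have hHcont (z : E') (hz : ∀ y ∈ K, ContDiffAt ℝ 1 H (y, z)) :
      ContinuousOn (fun y => H (y, z)) K := fun y hy =>
    ((hz y hy).continuousAt.comp (f := fun y => (y, z)) (hpair z y)).continuousWithinAt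
  obtain ⟨C, hC⟩ := hK.exists_bound_of_continuousOn hDcont
  have hnear : ∀ᶠ z in 𝓝 z₀, ∀ y ∈ K, ContDiffAt ℝ 1 H (y, z) ∧ ‖D (y, z)‖ < C + 1 :=
    hK.eventually_forall_of_forall_eventually fun y hy =>
      (continuous_swap.tendsto (z₀, y)).eventually (((hH y hy).eventually (by simp)).and
        ((hD y hy).norm.eventually_lt_const ((hC y hy).trans_lt (lt_add_one C))))
  refine hasFDerivAt_integral_of_dominated_of_fderiv_le (F' := fun z y => D (y, z))
    (bound := fun _ => C + 1) hnear (hnear.mono fun z hz => ?_) ?_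
    (aestronglyMeasurable_of_continuousOn_of_ae_mem hK hνK hDcont)
    (hνK.mono fun y hy z hz => (hz y hy).2.le) (integrable_const _)
    (hνK.mono fun y hy z hz => ((hz y hy).1.differentiableAt one_ne_zero).hasFDerivAt.comp z
      (hasFDerivAt_prodMk_right y z))
  · exact aestronglyMeasurable_of_continuousOn_of_ae_mem hK hνK
      (hHcont z fun y hy => (hz y hy).1)
  · exact restrict_eq_self_of_ae_mem hνK ▸ (hHcont z₀ hH).integrableOn_compact hK

variable (E) in
/-- The trace as a continuous linear functional on endomorphisms. -/
def clmTrace : (E →L[ℝ] E) →L[ℝ] ℝ :=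
  LinearMap.toContinuousLinearMap (LinearMap.trace ℝ E ∘ₗ ContinuousLinearMap.coeLM ℝ)

omit [MeasurableSpace E] [BorelSpace E] in
theorem clmTrace_fderiv_smul_comp {f : E → ℝ} {a : E → E} {y : E} (hf : DifferentiableAt ℝ f y)
    (ha : DifferentiableAt ℝ a y) (L : E →L[ℝ] E) :
    clmTrace E ((fderiv ℝ (fun z => f z • a z) y).comp L) =
      f y * clmTrace E ((fderiv ℝ a y).comp L) + fderiv ℝ f y (L (a y)) := by
  rw [fderiv_fun_smul hf ha, ContinuousLinearMap.add_comp, ContinuousLinearMap.smul_comp, map_add,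
    map_smul, smul_eq_mul]
  congr 1
  exact LinearMap.trace_smulRight (((fderiv ℝ f y).comp L : E →L[ℝ] ℝ) : E →ₗ[ℝ] ℝ) (a y)

omit [FiniteDimensional ℝ E] [MeasurableSpace E] [BorelSpace E] in
theorem contDiff_smul_of_tsupport_subset {U : Set E} (hU : IsOpen U) {f : E → ℝ} {a : E → F}
    {n : WithTop ℕ∞} (hf : ContDiff ℝ n f) (ha : ContDiffOn ℝ n a U) (hfU : tsupport f ⊆ U) :
    ContDiff ℝ n (f • a) :=
  (contMDiff_of_tsupport fun _ hy => (hf.contDiffAt.smul (ha.contDiffAt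
    (hU.mem_nhds (hfU (tsupport_smul_subset_left f a hy))))).contMDiffAt).contDiff

theorem integral_clmTrace_fderiv_smul_comp {U : Set E} (hU : IsOpen U) {Z : E → E →L[ℝ] E}
    {f : E → ℝ} {a : E → E} (hf : ContDiff ℝ 1 f) (hfc : HasCompactSupport f)
    (hfU : tsupport f ⊆ U) (ha : ContDiffOn ℝ 1 a U) (hZ : ContinuousOn Z U) :
    ∫ y, clmTrace E ((fderiv ℝ (f • a) y).comp (Z y)) ∂ν =
      ∫ y, f y * clmTrace E ((fderiv ℝ a y).comp (Z y)) ∂ν + ∫ y, fderiv ℝ f y (Z y (a y)) ∂ν := by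
  have hint {h : E → ℝ} (hh : ContinuousOn h U) (h0 : ∀ y ∉ tsupport f, h y = 0) :
      Integrable h ν :=
    (integrableOn_iff_integrable_of_support_subset (Function.support_subset_iff'.2 h0)).1
      ((hh.mono hfU).integrableOn_compact hfc.isCompact)
  have hτ : ContinuousOn (fun y => clmTrace E ((fderiv ℝ a y).comp (Z y))) U :=
    (clmTrace E).continuous.comp_continuousOn
      ((ha.continuousOn_fderiv_of_isOpen hU le_rfl).clm_comp hZ)
  refine Eq.trans ?_ (integral_add (hint (hf.continuous.continuousOn.mul hτ) fun y hy => ?_)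
    (hint ((hf.continuous_fderiv one_ne_zero).continuousOn.clm_apply
      (hZ.clm_apply ha.continuousOn)) fun y hy => ?_))
  · refine integral_congr_ae (.of_forall fun y => ?_)
    by_cases hy : y ∈ U
    · exact clmTrace_fderiv_smul_comp (hf.differentiable one_ne_zero y)
        ((ha.differentiableOn one_ne_zero).differentiableAt (hU.mem_nhds hy)) (Z y)
    · have hyf : y ∉ tsupport f := fun h => hy (hfU h)
      have hfa : fderiv ℝ (f • a) y = 0 :=
        fderiv_of_notMem_tsupport ℝ fun h => hyf (tsupport_smul_subset_left f a h)
      simp [hfa, fderiv_of_notMem_tsupport ℝ hyf, image_eq_zero_of_notMem_tsupport hyf]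
  · rw [image_eq_zero_of_notMem_tsupport hy, zero_mul]
  · rw [fderiv_of_notMem_tsupport ℝ hy, zero_apply]

theorem clmTrace_fderiv_comp_eq_zero_of_integral {U : Set E} (hU : IsOpen U) {Z : E → E →L[ℝ] E}
    {a : E → E} (ha : ContDiffOn ℝ 1 a U) (hZ : ContinuousOn Z U)
    (htrace : ∀ V : E → E, ContDiff ℝ 1 V → HasCompactSupport V → tsupport V ⊆ U →
      ∫ y, clmTrace E ((fderiv ℝ V y).comp (Z y)) ∂ν = 0)
    (hfield : ∀ f : E → ℝ, ContDiff ℝ 1 f → HasCompactSupport f → tsupport f ⊆ U →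
      ∫ y, fderiv ℝ f y (Z y (a y)) ∂ν = 0)
    {x₀ : E} (hx₀ : x₀ ∈ U) (hν : ∀ W ∈ 𝓝 x₀, ν W ≠ 0) :
    clmTrace E ((fderiv ℝ a x₀).comp (Z x₀)) = 0 := by
  set τ : E → ℝ := fun y => clmTrace E ((fderiv ℝ a y).comp (Z y))
  have hτ : ContinuousOn τ U := (clmTrace E).continuous.comp_continuousOn
    ((ha.continuousOn_fderiv_of_isOpen hU le_rfl).clm_comp hZ)
  have hae : ∀ᵐ y ∂ν, y ∈ U → τ y = 0 := by
    refine hU.ae_eq_zero_of_integral_contDiff_smul_eq_zero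
      (hτ.locallyIntegrableOn hU.measurableSet) fun f hf hfc hfU => ?_
    have hf1 : ContDiff ℝ 1 f := hf.of_le (by simp)
    have hparts := integral_clmTrace_fderiv_smul_comp (ν := ν) hU hf1 hfc hfU ha hZ
    rw [htrace _ (contDiff_smul_of_tsupport_subset hU hf1 ha hfU) hfc.smul_right
      ((tsupport_smul_subset_left f a).trans hfU), hfield f hf1 hfc hfU, add_zero] at hparts
    exact hparts.symm
  by_contra hne
  refine hν _ (Filter.inter_mem (hU.mem_nhds hx₀)
    ((hτ.continuousAt (hU.mem_nhds hx₀)).eventually_ne hne)) (measure_mono_null ?_ (ae_iff.1 hae))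
  exact fun y hy h => hy.2 (h hy.1)

end IntegrationByParts

section ChartMeasure

variable {X : Type*} [TopologicalSpace X] [MeasurableSpace X]
  {E : Type*} [NormedAddCommGroup E] [MeasurableSpace E]

/-- The push-forward to the model space, along the chart `φ`, of the restriction of `μ` to the
part of the chart domain corresponding to `K`. -/
def chartMeasure (μ : Measure X) (φ : OpenPartialHomeomorph X E) (K : Set E) : Measure E :=
  map φ (μ.restrict (φ.symm '' K))

variable {μ : Measure X} {φ : OpenPartialHomeomorph X E} {K : Set E}

omit [MeasurableSpace X] [MeasurableSpace E] in
theorem isCompact_chart_symm_image (hK : IsCompact K) (hKφ : K ⊆ φ.target) :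
    IsCompact (φ.symm '' K) :=
  hK.image_of_continuousOn (φ.continuousOn_symm.mono hKφ)

theorem isFiniteMeasure_chartMeasure [IsFiniteMeasureOnCompacts μ] (hK : IsCompact K)
    (hKφ : K ⊆ φ.target) : IsFiniteMeasure (chartMeasure μ φ K) :=
  have : IsFiniteMeasure (μ.restrict (φ.symm '' K)) :=
    isFiniteMeasure_restrict.2 (isCompact_chart_symm_image hK hKφ).measure_lt_top.ne
  isFiniteMeasure_map _ _

variable [T2Space X] [BorelSpace X] [BorelSpace E]

theorem aemeasurable_chart (hK : IsCompact K) (hKφ : K ⊆ φ.target) :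
    AEMeasurable φ (μ.restrict (φ.symm '' K)) :=
  (φ.continuousOn.mono (φ.symm.mapsTo.mono_left hKφ).image_subset).aemeasurable
    (isCompact_chart_symm_image hK hKφ).measurableSet

theorem ae_chartMeasure_mem (hK : IsCompact K) (hKφ : K ⊆ φ.target) :
    ∀ᵐ y ∂chartMeasure μ φ K, y ∈ K := by
  refine (ae_map_iff (aemeasurable_chart hK hKφ) hK.measurableSet).2 ?_
  filter_upwards [ae_restrict_mem (isCompact_chart_symm_image hK hKφ).measurableSet]
  rintro _ ⟨y, hy, rfl⟩
  rwa [φ.right_inv (hKφ hy)]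

theorem integrable_chartMeasure_of_continuousOn {F : Type*} [NormedAddCommGroup F]
    [IsFiniteMeasureOnCompacts μ] (hK : IsCompact K) (hKφ : K ⊆ φ.target) {f : E → F}
    (hf : ContinuousOn f K) : Integrable f (chartMeasure μ φ K) := by
  have := isFiniteMeasure_chartMeasure (μ := μ) hK hKφ
  exact restrict_eq_self_of_ae_mem (ae_chartMeasure_mem hK hKφ) ▸ hf.integrableOn_compact hK

theorem chartMeasure_ne_zero_of_mem_nhds [IsOpenPosMeasure μ] (hK : IsCompact K)
    (hKφ : K ⊆ φ.target) {y : E} (hyK : K ∈ 𝓝 y) {W : Set E} (hW : W ∈ 𝓝 y) :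
    chartMeasure μ φ K W ≠ 0 := by
  have hy : y ∈ φ.target := hKφ (mem_of_mem_nhds hyK)
  have hpre : φ ⁻¹' W ∩ φ.symm '' K ∈ 𝓝 (φ.symm y) := by
    refine Filter.inter_mem ((φ.continuousAt (φ.map_target hy)).preimage_mem_nhds ?_) ?_
    · rwa [φ.right_inv hy]
    · exact φ.symm.image_mem_nhds hy hyK
  have hle : μ (φ ⁻¹' W ∩ φ.symm '' K) ≤ chartMeasure μ φ K W :=
    (le_restrict_apply _ _).trans (le_map_apply (aemeasurable_chart hK hKφ) W)
  exact ((measure_pos_of_mem_nhds μ hpre).trans_le hle).ne'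

variable [NormedSpace ℝ E] [FiniteDimensional ℝ E]
  {F : Type*} [NormedAddCommGroup F] [NormedSpace ℝ F]

theorem integral_chartMeasure_comp (hK : IsCompact K) (hKφ : K ⊆ φ.target) {T : X → X}
    (hT : Continuous T) {V : E → F} (hV : Continuous V)
    (hTφ : ∀ x ∈ φ.symm '' K, T x ∈ φ.source)
    (hTK : ∀ x, T x ∈ φ.symm '' tsupport V → x ∈ φ.symm '' K) :
    ∫ y, V (φ (T (φ.symm y))) ∂chartMeasure μ φ K =
      ∫ x, φ.source.indicator (V ∘ φ) (T x) ∂μ := by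
  have hS := (isCompact_chart_symm_image hK hKφ).measurableSet
  have hcont : ContinuousOn (fun y => V (φ (T (φ.symm y)))) K :=
    hV.comp_continuousOn (φ.continuousOn.comp (hT.comp_continuousOn (φ.continuousOn_symm.mono hKφ))
      fun y hy => hTφ _ ⟨y, hy, rfl⟩)
  have hzero (x : X) (hx : x ∉ φ.symm '' K) : φ.source.indicator (V ∘ φ) (T x) = 0 := by
    by_cases hTx : T x ∈ φ.source
    · rw [Set.indicator_of_mem hTx]
      exact image_eq_zero_of_notMem_tsupport (f := V) fun h => hx (hTK x ⟨_, h, φ.left_inv hTx⟩)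
    · exact Set.indicator_of_notMem hTx _
  rw [chartMeasure, integral_map (aemeasurable_chart hK hKφ)
    (aestronglyMeasurable_of_continuousOn_of_ae_mem hK (ae_chartMeasure_mem hK hKφ) hcont),
    ← setIntegral_eq_integral_of_forall_compl_eq_zero hzero]
  refine setIntegral_congr_fun hS ?_
  rintro _ ⟨y, hy, rfl⟩
  simp only [φ.right_inv (hKφ hy)]
  exact (Set.indicator_of_mem (hTφ _ ⟨y, hy, rfl⟩) (V ∘ φ)).symm

theorem eventually_integral_chartMeasure_comp {Y : Type*} [TopologicalSpace Y] {y₀ : Y}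
    {T S : Y → X → X} (hT : Continuous fun p : Y × X => T p.1 p.2)
    (hS : Continuous fun p : Y × X => S p.1 p.2) (hT₀ : ∀ x, T y₀ x = x) (hS₀ : ∀ x, S y₀ x = x)
    (hST : ∀ y x, S y (T y x) = x) (hinv : ∀ (y : Y) (f : X → F), ∫ x, f (T y x) ∂μ = ∫ x, f x ∂μ)
    (hK : IsCompact K) (hKφ : K ⊆ φ.target) {V : E → F} (hV : Continuous V)
    (hVc : HasCompactSupport V) (hVK : tsupport V ⊆ interior K) :
    ∀ᶠ y in 𝓝 y₀, ∫ z, V (φ (T y (φ.symm z))) ∂chartMeasure μ φ K =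
      ∫ x, φ.source.indicator (V ∘ φ) x ∂μ := by
  have hVφ : tsupport V ⊆ φ.target := hVK.trans (interior_subset.trans hKφ)
  have hleave : ∀ᶠ y in 𝓝 y₀, ∀ x ∈ φ.symm '' K, T y x ∈ φ.source := by
    refine (isCompact_chart_symm_image hK hKφ).eventually_forall_of_forall_eventually ?_
    rintro _ ⟨z, hz, rfl⟩
    refine hT.continuousAt.eventually_mem (φ.open_source.mem_nhds ?_)
    simpa only [hT₀] using φ.map_target (hKφ hz)
  have henter : ∀ᶠ y in 𝓝 y₀, ∀ x ∈ φ.symm '' tsupport V, S y x ∈ φ.symm '' K := by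
    refine (isCompact_chart_symm_image hVc hVφ).eventually_forall_of_forall_eventually ?_
    rintro _ ⟨z, hz, rfl⟩
    refine hS.continuousAt.eventually_mem ?_
    simpa only [hS₀] using φ.symm.image_mem_nhds (hVφ hz) (mem_interior_iff_mem_nhds.1 (hVK hz))
  filter_upwards [hleave, henter] with y hy hy'
  rw [← hinv y]
  exact integral_chartMeasure_comp hK hKφ (hT.comp (.prodMk_right y)) hV hy
    fun x hx => hST y x ▸ hy' _ hx

end ChartMeasure

section ChartMul

variable {E : Type*} [NormedAddCommGroup E]
  {G : Type*} [Group G] [TopologicalSpace G] {φ : OpenPartialHomeomorph G E}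

/-- The multiplication of a group in a chart `φ`. -/
def chartMul (φ : OpenPartialHomeomorph G E) (p : E × E) : E := φ (φ.symm p.1 * φ.symm p.2)

theorem chartMul_one_left (h1 : (1 : G) ∈ φ.source) {y : E} (hy : y ∈ φ.target) :
    chartMul φ (φ 1, y) = y := by
  simp [chartMul, φ.left_inv h1, φ.right_inv hy]

theorem chartMul_one_right (h1 : (1 : G) ∈ φ.source) {y : E} (hy : y ∈ φ.target) :
    chartMul φ (y, φ 1) = y := by
  simp [chartMul, φ.left_inv h1, φ.right_inv hy]

theorem tendsto_chart_symm_one (h1 : (1 : G) ∈ φ.source) :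
    Filter.Tendsto φ.symm (𝓝 (φ 1)) (𝓝 1) := by
  simpa only [φ.left_inv h1] using (φ.continuousAt_symm (φ.map_source h1)).tendsto

variable [NormedSpace ℝ E] [FiniteDimensional ℝ E] [MeasurableSpace E] [BorelSpace E]
  [IsTopologicalGroup G] [T2Space G] [MeasurableSpace G] [BorelSpace G]
  {μ : Measure G} {K : Set E}
  {F : Type*} [NormedAddCommGroup F] [NormedSpace ℝ F] {V : E → F}

theorem eventually_integral_chartMul_right [IsMulRightInvariant μ] (h1 : (1 : G) ∈ φ.source)
    (hK : IsCompact K) (hKφ : K ⊆ φ.target) (hV : Continuous V) (hVc : HasCompactSupport V)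
    (hVK : tsupport V ⊆ interior K) :
    ∀ᶠ z in 𝓝 (φ 1), ∫ y, V (chartMul φ (y, z)) ∂chartMeasure μ φ K =
      ∫ x, φ.source.indicator (V ∘ φ) x ∂μ :=
  (tendsto_chart_symm_one h1).eventually <| eventually_integral_chartMeasure_comp
    (T := fun g x => x * g) (S := fun g x => x * g⁻¹) (by fun_prop) (by fun_prop) mul_one (by simp)
    (by simp) (fun g f => integral_mul_right_eq_self f g) hK hKφ hV hVc hVK

theorem eventually_integral_chartMul_left [IsMulLeftInvariant μ] (h1 : (1 : G) ∈ φ.source)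
    (hK : IsCompact K) (hKφ : K ⊆ φ.target) (hV : Continuous V) (hVc : HasCompactSupport V)
    (hVK : tsupport V ⊆ interior K) :
    ∀ᶠ z in 𝓝 (φ 1), ∫ y, V (chartMul φ (z, y)) ∂chartMeasure μ φ K =
      ∫ x, φ.source.indicator (V ∘ φ) x ∂μ :=
  (tendsto_chart_symm_one h1).eventually <| eventually_integral_chartMeasure_comp
    (T := fun g x => g * x) (S := fun g x => g⁻¹ * x) (by fun_prop) (by fun_prop) one_mul (by simp)
    (by simp) (fun g f => integral_mul_left_eq_self f g) hK hKφ hV hVc hVK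

variable [IsFiniteMeasureOnCompacts μ]

/-- The frame of left-invariant vector fields in a chart `φ`: the value at `y` of the field which
is `w` at the identity is `leftChartFrame φ y w`. -/
def leftChartFrame (φ : OpenPartialHomeomorph G E) (y : E) : E →L[ℝ] E :=
  (fderiv ℝ (chartMul φ) (y, φ 1)).comp (.inr ℝ E E)

/-- The frame of right-invariant vector fields in a chart `φ`: the value at `y` of the field which
is `w` at the identity is `rightChartFrame φ y w`. -/
def rightChartFrame (φ : OpenPartialHomeomorph G E) (y : E) : E →L[ℝ] E :=
  (fderiv ℝ (chartMul φ) (φ 1, y)).comp (.inl ℝ E E)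

theorem integral_fderiv_comp_leftChartFrame [IsMulRightInvariant μ] (h1 : (1 : G) ∈ φ.source)
    (hK : IsCompact K) (hKφ : K ⊆ φ.target)
    (hm : ∀ y ∈ K, ContDiffAt ℝ 1 (chartMul φ) (y, φ 1)) (hV : ContDiff ℝ 1 V)
    (hVc : HasCompactSupport V) (hVK : tsupport V ⊆ interior K) :
    ∫ y, (fderiv ℝ V y).comp (leftChartFrame φ y) ∂chartMeasure μ φ K = 0 := by
  have := isFiniteMeasure_chartMeasure (μ := μ) hK hKφ
  have hνK := ae_chartMeasure_mem (μ := μ) hK hKφ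
  have hderiv := (hasFDerivAt_integral_of_contDiffAt hK hνK
    fun y hy => hV.contDiffAt.comp _ (hm y hy)).unique
      ((hasFDerivAt_const _ _).congr_of_eventuallyEq
        (eventually_integral_chartMul_right h1 hK hKφ hV.continuous hVc hVK))
  refine (integral_congr_ae (hνK.mono fun y hy => ?_)).trans hderiv
  change (fderiv ℝ V y).comp _ = (fderiv ℝ (V ∘ chartMul φ) (y, φ 1)).comp _
  rw [fderiv_comp _ (hV.differentiable one_ne_zero _) ((hm y hy).differentiableAt one_ne_zero),
    chartMul_one_right h1 (hKφ hy), ContinuousLinearMap.comp_assoc, leftChartFrame]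

theorem integral_fderiv_comp_rightChartFrame [IsMulLeftInvariant μ] (h1 : (1 : G) ∈ φ.source)
    (hK : IsCompact K) (hKφ : K ⊆ φ.target)
    (hm : ∀ y ∈ K, ContDiffAt ℝ 1 (chartMul φ) (φ 1, y)) (hV : ContDiff ℝ 1 V)
    (hVc : HasCompactSupport V) (hVK : tsupport V ⊆ interior K) :
    ∫ y, (fderiv ℝ V y).comp (rightChartFrame φ y) ∂chartMeasure μ φ K = 0 := by
  have := isFiniteMeasure_chartMeasure (μ := μ) hK hKφ
  have hνK := ae_chartMeasure_mem (μ := μ) hK hKφ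
  have hswap (y : E) (hy : y ∈ K) : ContDiffAt ℝ 1 (chartMul φ ∘ Prod.swap) (y, φ 1) :=
    ContDiffAt.comp (y, φ 1) (hm y hy) (contDiff_snd.prodMk contDiff_fst).contDiffAt
  have hderiv := (hasFDerivAt_integral_of_contDiffAt hK hνK
    fun y hy => hV.contDiffAt.comp _ (hswap y hy)).unique
      ((hasFDerivAt_const _ _).congr_of_eventuallyEq
        (eventually_integral_chartMul_left h1 hK hKφ hV.continuous hVc hVK))
  refine (integral_congr_ae (hνK.mono fun y hy => ?_)).trans hderiv
  have hmul : HasFDerivAt (chartMul φ ∘ Prod.swap)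
      ((fderiv ℝ (chartMul φ) (φ 1, y)).comp ((ContinuousLinearMap.snd ℝ E E).prod
        (.fst ℝ E E))) (y, φ 1) :=
    HasFDerivAt.comp (y, φ 1) ((hm y hy).differentiableAt one_ne_zero).hasFDerivAt
      (hasFDerivAt_snd.prodMk hasFDerivAt_fst)
  change (fderiv ℝ V y).comp _ = (fderiv ℝ (V ∘ chartMul φ ∘ Prod.swap) (y, φ 1)).comp _
  rw [fderiv_comp _ (hV.differentiable one_ne_zero _) hmul.differentiableAt, hmul.fderiv,
    Function.comp_apply, Prod.swap_prod_mk, chartMul_one_left h1 (hKφ hy)]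
  ext w
  simp [rightChartFrame]

end ChartMul

section ChartFrame

variable {E : Type*} [NormedAddCommGroup E] [NormedSpace ℝ E]
  {G : Type*} [Group G] [TopologicalSpace G] {φ : OpenPartialHomeomorph G E}

theorem leftChartFrame_one (h1 : (1 : G) ∈ φ.source)
    (hm : DifferentiableAt ℝ (chartMul φ) (φ 1, φ 1)) :
    leftChartFrame φ (φ 1) = .id ℝ E := by
  refine (hm.hasFDerivAt.comp (φ 1) (hasFDerivAt_prodMk_right (φ 1) (φ 1))).unique
    ((hasFDerivAt_id (φ 1)).congr_of_eventuallyEq ?_)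
  filter_upwards [φ.open_target.mem_nhds (φ.map_source h1)] with y hy using chartMul_one_left h1 hy

theorem rightChartFrame_one (h1 : (1 : G) ∈ φ.source)
    (hm : DifferentiableAt ℝ (chartMul φ) (φ 1, φ 1)) :
    rightChartFrame φ (φ 1) = .id ℝ E := by
  refine (HasFDerivAt.comp (f := fun y => (y, φ 1)) (φ 1) hm.hasFDerivAt
    (hasFDerivAt_prodMk_left (φ 1) (φ 1))).unique ((hasFDerivAt_id (φ 1)).congr_of_eventuallyEq ?_)
  filter_upwards [φ.open_target.mem_nhds (φ.map_source h1)] with y hy using chartMul_one_right h1 hy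

theorem contDiffAt_leftChartFrame {y : E} (hm : ContDiffAt ℝ 2 (chartMul φ) (y, φ 1)) :
    ContDiffAt ℝ 1 (leftChartFrame φ) y :=
  (ContDiffAt.comp (f := fun z => (z, φ 1)) y (hm.fderiv_right (m := 1) (by norm_num))
    (contDiffAt_id.prodMk contDiffAt_const)).clm_comp contDiffAt_const

theorem contDiffAt_rightChartFrame {y : E} (hm : ContDiffAt ℝ 2 (chartMul φ) (φ 1, y)) :
    ContDiffAt ℝ 1 (rightChartFrame φ) y :=
  (ContDiffAt.comp (f := fun z => (φ 1, z)) y (hm.fderiv_right (m := 1) (by norm_num))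
    (contDiffAt_const.prodMk contDiffAt_id)).clm_comp contDiffAt_const

theorem fderiv_rightChartFrame (hm : ContDiffAt ℝ 2 (chartMul φ) (φ 1, φ 1)) :
    fderiv ℝ (rightChartFrame φ) (φ 1) = (fderiv ℝ (leftChartFrame φ) (φ 1)).flip := by
  have hD : HasFDerivAt (fderiv ℝ (chartMul φ)) _ (φ 1, φ 1) :=
    ((hm.fderiv_right (m := 1) (by norm_num)).differentiableAt one_ne_zero).hasFDerivAt
  have hright : HasFDerivAt (rightChartFrame φ) _ (φ 1) :=
    (HasFDerivAt.comp (φ 1) hD (hasFDerivAt_prodMk_right (φ 1) (φ 1))).clm_comp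
      (hasFDerivAt_const (ContinuousLinearMap.inl ℝ E E) (φ 1))
  have hleft : HasFDerivAt (leftChartFrame φ) _ (φ 1) :=
    (HasFDerivAt.comp (f := fun y => (y, φ 1)) (φ 1) hD
      (hasFDerivAt_prodMk_left (φ 1) (φ 1))).clm_comp
      (hasFDerivAt_const (ContinuousLinearMap.inr ℝ E E) (φ 1))
  rw [hright.fderiv, hleft.fderiv]
  ext v w
  simpa using (hm.isSymmSndFDerivAt (by simp)).eq (0, v) (w, 0)

/-- The components in the left-invariant frame of the right-invariant vector field which is `w` at
the identity. -/
def rightChartComponents (φ : OpenPartialHomeomorph G E) (w y : E) : E :=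
  (leftChartFrame φ y).inverse (rightChartFrame φ y w)

theorem eventually_isInvertible_leftChartFrame [CompleteSpace E] (h1 : (1 : G) ∈ φ.source)
    (hm : ContDiffAt ℝ 2 (chartMul φ) (φ 1, φ 1)) :
    ∀ᶠ y in 𝓝 (φ 1), (leftChartFrame φ y).IsInvertible := by
  refine (contDiffAt_leftChartFrame hm).continuousAt.eventually_mem
    ((ContinuousLinearEquiv.isOpen (𝕜 := ℝ) (E := E) (F := E)).mem_nhds ?_)
  exact ⟨.refl ℝ E, (leftChartFrame_one h1 (hm.differentiableAt two_ne_zero)).symm⟩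

theorem contDiffAt_rightChartComponents [CompleteSpace E] {y : E}
    (hl : ContDiffAt ℝ 2 (chartMul φ) (y, φ 1)) (hr : ContDiffAt ℝ 2 (chartMul φ) (φ 1, y))
    (hinv : (leftChartFrame φ y).IsInvertible) (w : E) :
    ContDiffAt ℝ 1 (rightChartComponents φ w) y :=
  (ContDiffAt.comp y hinv.contDiffAt_map_inverse (contDiffAt_leftChartFrame hl)).clm_apply
    ((contDiffAt_rightChartFrame hr).clm_apply contDiffAt_const)

theorem fderiv_rightChartComponents [CompleteSpace E] (h1 : (1 : G) ∈ φ.source)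
    (hm : ContDiffAt ℝ 2 (chartMul φ) (φ 1, φ 1)) (w : E) :
    fderiv ℝ (rightChartComponents φ w) (φ 1) =
      fderiv ℝ (leftChartFrame φ) (φ 1) w - (fderiv ℝ (leftChartFrame φ) (φ 1)).flip w := by
  have hinv := eventually_isInvertible_leftChartFrame h1 hm
  have hmd := hm.differentiableAt two_ne_zero
  have hval : rightChartComponents φ w (φ 1) = w := by
    simp [rightChartComponents, leftChartFrame_one h1 hmd, rightChartFrame_one h1 hmd]
  have hprod : (fun y => leftChartFrame φ y (rightChartComponents φ w y)) =ᶠ[𝓝 (φ 1)]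
      fun y => rightChartFrame φ y w := hinv.mono fun y hy => hy.self_apply_inverse _
  have ha := (contDiffAt_rightChartComponents hm hm hinv.self_of_nhds w).differentiableAt
    one_ne_zero
  have hL := (contDiffAt_leftChartFrame hm).differentiableAt one_ne_zero
  have hR := (contDiffAt_rightChartFrame hm).differentiableAt one_ne_zero
  have hderiv := hprod.fderiv_eq (𝕜 := ℝ)
  rw [fderiv_clm_apply hL ha, fderiv_clm_apply hR (differentiableAt_const w),
    fderiv_rightChartFrame hm, leftChartFrame_one h1 hmd, hval] at hderiv
  simp only [fderiv_fun_const, Pi.zero_apply, ContinuousLinearMap.id_comp,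
    ContinuousLinearMap.comp_zero, zero_add, ContinuousLinearMap.flip_flip] at hderiv
  exact eq_sub_of_add_eq hderiv

end ChartFrame

section ModularTrace

variable {E : Type*} [NormedAddCommGroup E] [NormedSpace ℝ E] [FiniteDimensional ℝ E]
  {G : Type*} [Group G] [TopologicalSpace G] {φ : OpenPartialHomeomorph G E}

theorem exists_isCompact_mem_nhds_chart_one (h1 : (1 : G) ∈ φ.source)
    (hm : ContDiffAt ℝ 2 (chartMul φ) (φ 1, φ 1)) :
    ∃ K ∈ 𝓝 (φ 1), IsCompact K ∧ K ⊆ φ.target ∧ ∀ y ∈ K, ContDiffAt ℝ 2 (chartMul φ) (y, φ 1) ∧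
      ContDiffAt ℝ 2 (chartMul φ) (φ 1, y) ∧ (leftChartFrame φ y).IsInvertible := by
  have hsmooth : ∀ᶠ p in 𝓝 (φ 1, φ 1), ContDiffAt ℝ 2 (chartMul φ) p := hm.eventually (by simp)
  have hleft := (Continuous.prodMk_left (φ 1)).tendsto (φ 1) |>.eventually hsmooth
  have hright := (Continuous.prodMk_right (φ 1)).tendsto (φ 1) |>.eventually hsmooth
  obtain ⟨K, hK, hKsub, hKc⟩ := local_compact_nhds
    ((φ.open_target.eventually_mem (φ.map_source h1)).and
      (hleft.and (hright.and (eventually_isInvertible_leftChartFrame h1 hm))))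
  exact ⟨K, hK, hKc, fun y hy => (hKsub hy).1, fun y hy => (hKsub hy).2⟩

theorem clmTrace_fderiv_leftChartFrame_eq_zero [IsTopologicalGroup G] [T2Space G]
    [MeasurableSpace G] [BorelSpace G]
    (μ : Measure G) [IsHaarMeasure μ] [IsMulRightInvariant μ] (h1 : (1 : G) ∈ φ.source)
    (hm : ContDiffAt ℝ 2 (chartMul φ) (φ 1, φ 1)) (w : E) :
    clmTrace E (fderiv ℝ (leftChartFrame φ) (φ 1) w -
      (fderiv ℝ (leftChartFrame φ) (φ 1)).flip w) = 0 := by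
  borelize E
  obtain ⟨K, hK, hKc, hKφ, hKm⟩ := exists_isCompact_mem_nhds_chart_one h1 hm
  have hleft : ContinuousOn (leftChartFrame φ) K := fun y hy =>
    (contDiffAt_leftChartFrame (hKm y hy).1).continuousAt.continuousWithinAt
  have hright : ContinuousOn (rightChartFrame φ) K := fun y hy =>
    (contDiffAt_rightChartFrame (hKm y hy).2.1).continuousAt.continuousWithinAt
  have := isFiniteMeasure_chartMeasure (μ := μ) hKc hKφ
  have htrace (V : E → E) (hV : ContDiff ℝ 1 V) (hVc : HasCompactSupport V)
      (hVK : tsupport V ⊆ interior K) :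
      ∫ y, clmTrace E ((fderiv ℝ V y).comp (leftChartFrame φ y)) ∂chartMeasure μ φ K = 0 := by
    rw [(clmTrace E).integral_comp_comm (integrable_chartMeasure_of_continuousOn hKc hKφ
        ((hV.continuous_fderiv one_ne_zero).continuousOn.clm_comp hleft)),
      integral_fderiv_comp_leftChartFrame h1 hKc hKφ (fun y hy => (hKm y hy).1.of_le one_le_two)
        hV hVc hVK, map_zero]
  have hfield (f : E → ℝ) (hf : ContDiff ℝ 1 f) (hfc : HasCompactSupport f)
      (hfK : tsupport f ⊆ interior K) :
      ∫ y, fderiv ℝ f y (leftChartFrame φ y (rightChartComponents φ w y))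
        ∂chartMeasure μ φ K = 0 := by
    have hae : ∀ᵐ y ∂chartMeasure μ φ K,
        fderiv ℝ f y (leftChartFrame φ y (rightChartComponents φ w y)) =
          ((fderiv ℝ f y).comp (rightChartFrame φ y)) w :=
      (ae_chartMeasure_mem hKc hKφ).mono fun y hy =>
        congrArg (fderiv ℝ f y) ((hKm y hy).2.2.self_apply_inverse _)
    rw [integral_congr_ae hae, ← ContinuousLinearMap.integral_apply
      (integrable_chartMeasure_of_continuousOn hKc hKφ
        ((hf.continuous_fderiv one_ne_zero).continuousOn.clm_comp hright)),
      integral_fderiv_comp_rightChartFrame h1 hKc hKφ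
        (fun y hy => (hKm y hy).2.1.of_le one_le_two) hf hfc hfK, zero_apply]
  have hzero := clmTrace_fderiv_comp_eq_zero_of_integral isOpen_interior (Z := leftChartFrame φ)
    (a := rightChartComponents φ w)
    (fun y hy => have hy := hKm y (interior_subset hy)
      (contDiffAt_rightChartComponents hy.1 hy.2.1 hy.2.2 w).contDiffWithinAt)
    (hleft.mono interior_subset) htrace hfield (mem_interior_iff_mem_nhds.2 hK)
    fun W hW => chartMeasure_ne_zero_of_mem_nhds hKc hKφ hK hW
  rwa [fderiv_rightChartComponents h1 hm, leftChartFrame_one h1 (hm.differentiableAt two_ne_zero),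
    ContinuousLinearMap.comp_id] at hzero

end ModularTrace

end UnimodularGroup

section LeftFrame

open VectorField

variable {E : Type*} [NormedAddCommGroup E] [NormedSpace ℂ E]

theorem mdifferentiable_of_mem_maximalAtlas {M : Type*} [TopologicalSpace M] [ChartedSpace E M]
    [IsManifold 𝓘(ℂ, E) ω M] {ε : OpenPartialHomeomorph M E}
    (hε : ε ∈ IsManifold.maximalAtlas 𝓘(ℂ, E) ω M) : ε.MDifferentiable 𝓘(ℂ, E) 𝓘(ℂ, E) :=
  ⟨(contMDiffOn_of_mem_maximalAtlas hε).mdifferentiableOn (by simp),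
    (contMDiffOn_symm_of_mem_maximalAtlas hε).mdifferentiableOn (by simp)⟩

theorem isInvertible_mfderiv_chart_symm {M : Type*} [TopologicalSpace M] [ChartedSpace E M]
    [IsManifold 𝓘(ℂ, E) ω M] {ε : OpenPartialHomeomorph M E}
    (hε : ε ∈ IsManifold.maximalAtlas 𝓘(ℂ, E) ω M) {y : E} (hy : y ∈ ε.target) :
    (mfderiv 𝓘(ℂ, E) 𝓘(ℂ, E) ε.symm y : E →L[ℂ] E).IsInvertible :=
  ⟨(mdifferentiable_of_mem_maximalAtlas hε).symm.mfderiv hy, rfl⟩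

theorem mlieBracket_eq_lieBracket {V W : Π y : E, TangentSpace 𝓘(ℂ, E) y} :
    mlieBracket 𝓘(ℂ, E) V W = lieBracket ℂ V W := by
  rw [← mlieBracketWithin_univ, mlieBracketWithin_eq_lieBracketWithin]
  exact lieBracketWithin_univ

variable {G : Type*} [Group G] [TopologicalSpace G] [ChartedSpace E G]

/-- The frame of left-invariant vector fields of a complex Lie group in the chart `ε`: the value
at `y` of the field which is `u` at the identity is `leftFrame ε y u`. -/
def leftFrame (ε : OpenPartialHomeomorph G E) (y : E) : E →L[ℂ] E :=
  (ContinuousLinearMap.inverse (mfderiv 𝓘(ℂ, E) 𝓘(ℂ, E) ε.symm y : E →L[ℂ] E)).comp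
    (mfderiv 𝓘(ℂ, E) 𝓘(ℂ, E) (fun c : G => ε.symm y * c) 1 : E →L[ℂ] E)

/-- The Maurer-Cartan form, i.e. the left-invariant coframe dual to `leftFrame`, in the
chart `ε`. -/
def maurerCartanForm (ε : OpenPartialHomeomorph G E) (y : E) : E →L[ℝ] E :=
  (ContinuousLinearMap.inverse (leftFrame ε y)).restrictScalars ℝ

variable [LieGroup 𝓘(ℂ, E) ω G]

theorem mfderiv_inv_mul_left_comp_mfderiv_mul_left (a b : G) :
    (mfderiv 𝓘(ℂ, E) 𝓘(ℂ, E) (fun c : G => a⁻¹ * c) (a * b) : E →L[ℂ] E).comp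
      (mfderiv 𝓘(ℂ, E) 𝓘(ℂ, E) (fun c : G => a * c) b : E →L[ℂ] E) = .id ℂ E := by
  have hcomp := mfderiv_comp b (mdifferentiableAt_mul_left (I := 𝓘(ℂ, E)) (a := a⁻¹) (b := a * b))
    (mdifferentiableAt_mul_left (a := a))
  have hid : ((fun c : G => a⁻¹ * c) ∘ fun c => a * c) = id := funext (inv_mul_cancel_left a)
  rw [hid, mfderiv_id] at hcomp
  exact hcomp.symm

theorem isInvertible_mfderiv_mul_left (a b : G) :
    (mfderiv 𝓘(ℂ, E) 𝓘(ℂ, E) (fun c : G => a * c) b : E →L[ℂ] E).IsInvertible := by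
  have hright := mfderiv_inv_mul_left_comp_mfderiv_mul_left (E := E) a⁻¹ (a * b)
  rw [inv_inv, inv_mul_cancel_left] at hright
  exact .of_inverse hright (mfderiv_inv_mul_left_comp_mfderiv_mul_left a b)

variable {ε : OpenPartialHomeomorph G E}

theorem isInvertible_leftFrame (hε : ε ∈ IsManifold.maximalAtlas 𝓘(ℂ, E) ω G) {y : E}
    (hy : y ∈ ε.target) : (leftFrame ε y).IsInvertible :=
  (isInvertible_mfderiv_chart_symm hε hy).inverse.comp (isInvertible_mfderiv_mul_left _ _)

theorem maurerCartanForm_leftFrame (hε : ε ∈ IsManifold.maximalAtlas 𝓘(ℂ, E) ω G) {y : E}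
    (hy : y ∈ ε.target) (u : E) : maurerCartanForm ε y (leftFrame ε y u) = u :=
  (isInvertible_leftFrame hε hy).inverse_apply_self u

theorem leftFrame_maurerCartanForm (hε : ε ∈ IsManifold.maximalAtlas 𝓘(ℂ, E) ω G) {y : E}
    (hy : y ∈ ε.target) (u : E) : leftFrame ε y (maurerCartanForm ε y u) = u :=
  (isInvertible_leftFrame hε hy).self_apply_inverse u

theorem isInvertible_maurerCartanForm (hε : ε ∈ IsManifold.maximalAtlas 𝓘(ℂ, E) ω G) {y : E}
    (hy : y ∈ ε.target) : (maurerCartanForm ε y).IsInvertible :=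
  .of_inverse (g := (leftFrame ε y).restrictScalars ℝ)
    (ContinuousLinearMap.ext (maurerCartanForm_leftFrame hε hy))
    (ContinuousLinearMap.ext (leftFrame_maurerCartanForm hε hy))

variable [FiniteDimensional ℂ E]

theorem contDiffAt_leftFrame (hε : ε ∈ IsManifold.maximalAtlas 𝓘(ℂ, E) ω G) {y : E}
    (hy : y ∈ ε.target) : ContDiffAt ℂ 2 (leftFrame ε) y := by
  have : CompleteSpace E := FiniteDimensional.complete ℂ E
  have : LieGroup 𝓘(ℂ, E) (minSmoothness ℂ 3) G := LieGroup.of_le (n := ω) le_top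
  refine (contDiffOn_clm_apply.2 fun u z hz => ?_).contDiffAt (ε.open_target.mem_nhds hy)
  have hfield := contMDiffAt_mulInvariantVectorField (I := 𝓘(ℂ, E)) u (g := ε.symm z)
  have hpull := ContMDiffAt.mpullback_vectorField_preimage (n := ω) (hfield.of_le le_minSmoothness)
    (contMDiffAt_symm_of_mem_maximalAtlas hε hz) (isInvertible_mfderiv_chart_symm hε hz) le_top
  exact (contMDiffAt_vectorSpace_iff_contDiffAt.1 hpull).contDiffWithinAt

theorem hasFDerivAt_leftFrame_apply (hε : ε ∈ IsManifold.maximalAtlas 𝓘(ℂ, E) ω G) {y : E}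
    (hy : y ∈ ε.target) (u : E) :
    HasFDerivAt (fun z => leftFrame ε z u) ((fderiv ℂ (leftFrame ε) y).flip u) y :=
  (ContinuousLinearMap.apply ℂ E u).hasFDerivAt.comp y
    ((contDiffAt_leftFrame hε hy).differentiableAt two_ne_zero).hasFDerivAt

variable (E G) in
/-- The bracket of the Lie algebra of a complex Lie group, carried over to the model space `E`,
which is by definition the tangent space at the identity. -/
def groupLieBracket : E →L[ℂ] E →L[ℂ] E :=
  haveI : CompleteSpace E := FiniteDimensional.complete ℂ E
  haveI : LieGroup 𝓘(ℂ, E) (minSmoothness ℂ 3) G := LieGroup.of_le (n := ω) le_top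
  let 𝔤 := GroupLieAlgebra 𝓘(ℂ, E) G
  LinearMap.toContinuousBilinearMap <| LinearMap.mk₂ ℂ (Bracket.bracket (L := 𝔤) (M := 𝔤))
    (add_lie (L := 𝔤) (M := 𝔤)) (smul_lie (L := 𝔤) (M := 𝔤))
    (lie_add (L := 𝔤) (M := 𝔤)) (lie_smul (L := 𝔤) (M := 𝔤))

variable (E G) in
theorem isComplexBracket_groupLieBracket :
    Hermitian.IsComplexBracket ((groupLieBracket E G).bilinearRestrictScalars ℝ) where
  skew _ _ :=
    haveI : CompleteSpace E := FiniteDimensional.complete ℂ E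
    haveI : LieGroup 𝓘(ℂ, E) (minSmoothness ℂ 3) G := LieGroup.of_le (n := ω) le_top
    lie_skew (L := GroupLieAlgebra 𝓘(ℂ, E) G) _ _
  map_J_right u v := (groupLieBracket E G u).map_smul Complex.I v

theorem lieBracket_leftFrame (hε : ε ∈ IsManifold.maximalAtlas 𝓘(ℂ, E) ω G) {y : E}
    (hy : y ∈ ε.target) (u v : E) :
    lieBracket ℂ (fun z => leftFrame ε z u) (fun z => leftFrame ε z v) y =
      leftFrame ε y (groupLieBracket E G u v) := by
  have : CompleteSpace E := FiniteDimensional.complete ℂ E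
  have : LieGroup 𝓘(ℂ, E) (minSmoothness ℂ 3) G := LieGroup.of_le (n := ω) le_top
  let V (w : E) := mulInvariantVectorField (I := 𝓘(ℂ, E)) (G := G) w
  have hpull : mpullback 𝓘(ℂ, E) 𝓘(ℂ, E) ε.symm (mlieBracket 𝓘(ℂ, E) (V u) (V v)) y =
      mlieBracket 𝓘(ℂ, E) (mpullback 𝓘(ℂ, E) 𝓘(ℂ, E) ε.symm (V u))
        (mpullback 𝓘(ℂ, E) 𝓘(ℂ, E) ε.symm (V v)) y :=
    mpullback_mlieBracket (n := ω) (mdifferentiableAt_mulInvariantVectorField _)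
      (mdifferentiableAt_mulInvariantVectorField _)
      (contMDiffAt_symm_of_mem_maximalAtlas hε hy) le_top
  have hbracket : V (groupLieBracket E G u v) = mlieBracket 𝓘(ℂ, E) (V u) (V v) :=
    mulInvariantVector_mlieBracket (I := 𝓘(ℂ, E)) (G := G) u v
  rw [← hbracket] at hpull
  exact (congrFun mlieBracket_eq_lieBracket y).symm.trans hpull.symm

theorem fderiv_leftFrame_sub_swap (hε : ε ∈ IsManifold.maximalAtlas 𝓘(ℂ, E) ω G) {y : E}
    (hy : y ∈ ε.target) (u v : E) :
    fderiv ℂ (leftFrame ε) y (leftFrame ε y u) v - fderiv ℂ (leftFrame ε) y (leftFrame ε y v) u =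
      leftFrame ε y (groupLieBracket E G u v) := by
  rw [← lieBracket_leftFrame hε hy, lieBracket, (hasFDerivAt_leftFrame_apply hε hy u).fderiv,
    (hasFDerivAt_leftFrame_apply hε hy v).fderiv]
  rfl

theorem contDiffAt_maurerCartanForm (hε : ε ∈ IsManifold.maximalAtlas 𝓘(ℂ, E) ω G) {y : E}
    (hy : y ∈ ε.target) : ContDiffAt ℝ 2 (maurerCartanForm ε) y := by
  have : CompleteSpace E := FiniteDimensional.complete ℂ E
  obtain ⟨e, he⟩ := isInvertible_leftFrame hε hy
  have hinv : ContDiffAt ℂ 2 (ContinuousLinearMap.inverse : (E →L[ℂ] E) → E →L[ℂ] E)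
      (leftFrame ε y) := he ▸ contDiffAt_map_inverse e
  exact (ContinuousLinearMap.restrictScalarsL ℂ E E ℝ ℝ).contDiff.contDiffAt.comp y
    ((hinv.comp y (contDiffAt_leftFrame hε hy)).restrict_scalars ℝ)

theorem fderiv_maurerCartanForm_leftFrame (hε : ε ∈ IsManifold.maximalAtlas 𝓘(ℂ, E) ω G) {y : E}
    (hy : y ∈ ε.target) (A u : E) : fderiv ℝ (maurerCartanForm ε) y A (leftFrame ε y u) =
      -maurerCartanForm ε y (fderiv ℂ (leftFrame ε) y A u) := by
  have hprod := ((contDiffAt_maurerCartanForm hε hy).differentiableAt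
    two_ne_zero).hasFDerivAt.clm_apply ((hasFDerivAt_leftFrame_apply hε hy u).restrictScalars ℝ)
  have hconst : (fun z => maurerCartanForm ε z (leftFrame ε z u)) =ᶠ[𝓝 y] fun _ => u := by
    filter_upwards [ε.open_target.mem_nhds hy] with z hz using maurerCartanForm_leftFrame hε hz u
  have hzero := hprod.unique ((hasFDerivAt_const u y).congr_of_eventuallyEq hconst)
  exact eq_neg_of_add_eq_zero_right (DFunLike.congr_fun hzero A)

theorem fderiv_maurerCartanForm_sub_swap (hε : ε ∈ IsManifold.maximalAtlas 𝓘(ℂ, E) ω G) {y : E}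
    (hy : y ∈ ε.target) (A B : E) :
    fderiv ℝ (maurerCartanForm ε) y A B - fderiv ℝ (maurerCartanForm ε) y B A =
      -groupLieBracket E G (maurerCartanForm ε y A) (maurerCartanForm ε y B) := by
  obtain ⟨u, rfl⟩ : ∃ u, leftFrame ε y u = A := ⟨_, leftFrame_maurerCartanForm hε hy A⟩
  obtain ⟨v, rfl⟩ : ∃ v, leftFrame ε y v = B := ⟨_, leftFrame_maurerCartanForm hε hy B⟩
  rw [fderiv_maurerCartanForm_leftFrame hε hy, fderiv_maurerCartanForm_leftFrame hε hy,
    maurerCartanForm_leftFrame hε hy, maurerCartanForm_leftFrame hε hy,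
    ← maurerCartanForm_leftFrame hε hy (groupLieBracket E G u v),
    ← fderiv_leftFrame_sub_swap hε hy, map_sub]
  abel

end LeftFrame

section UnimodularLieAlgebra

variable {E : Type*} [NormedAddCommGroup E] [NormedSpace ℂ E]
  {G : Type*} [Group G] [TopologicalSpace G] [ChartedSpace E G]
  [LieGroup 𝓘(ℂ, E) ω G] {φ : OpenPartialHomeomorph G E}

theorem contDiffAt_chartMul (hφ : φ ∈ IsManifold.maximalAtlas 𝓘(ℂ, E) ω G)
    (h1 : (1 : G) ∈ φ.source) {y : E} (hy : y ∈ φ.target) :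
    ContDiffAt ℂ ω (chartMul φ) (y, φ 1) := by
  have hleft : ContMDiffAt 𝓘(ℂ, E × E) 𝓘(ℂ, E) ω (fun p : E × E => φ.symm p.1) (y, φ 1) :=
    ContMDiffAt.comp (y, φ 1) (g := φ.symm) (f := Prod.fst)
      (contMDiffAt_symm_of_mem_maximalAtlas hφ hy) contDiff_fst.contMDiff.contMDiffAt
  have hright : ContMDiffAt 𝓘(ℂ, E × E) 𝓘(ℂ, E) ω (fun p : E × E => φ.symm p.2) (y, φ 1) :=
    ContMDiffAt.comp (y, φ 1) (g := φ.symm) (f := Prod.snd)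
      (contMDiffAt_symm_of_mem_maximalAtlas hφ (φ.map_source h1))
      contDiff_snd.contMDiff.contMDiffAt
  refine (ContMDiffAt.comp (y, φ 1) (g := φ) (contMDiffAt_of_mem_maximalAtlas hφ ?_)
    (hleft.mul hright)).contDiffAt
  simpa only [Pi.mul_apply, φ.left_inv h1, mul_one] using φ.map_target hy

theorem leftChartFrame_apply (hφ : φ ∈ IsManifold.maximalAtlas 𝓘(ℂ, E) ω G)
    (h1 : (1 : G) ∈ φ.source) {y : E} (hy : y ∈ φ.target) (w : E) :
    leftChartFrame φ y w =
      leftFrame φ y ((mfderiv 𝓘(ℂ, E) 𝓘(ℂ, E) φ.symm (φ 1) : E →L[ℂ] E) w) := by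
  have hd := mdifferentiable_of_mem_maximalAtlas hφ
  have hinv : ContinuousLinearMap.inverse (mfderiv 𝓘(ℂ, E) 𝓘(ℂ, E) φ.symm y : E →L[ℂ] E) =
      (mfderiv 𝓘(ℂ, E) 𝓘(ℂ, E) φ (φ.symm y) : E →L[ℂ] E) :=
    ContinuousLinearMap.inverse_equiv (hd.symm.mfderiv hy)
  have hsymm := (hd.mdifferentiableAt_symm (φ.map_source h1)).hasMFDerivAt
  have hmul : HasMFDerivAt 𝓘(ℂ, E) 𝓘(ℂ, E) (fun c : G => φ.symm y * c) (φ.symm (φ 1))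
      (mfderiv 𝓘(ℂ, E) 𝓘(ℂ, E) (fun c : G => φ.symm y * c) 1) := by
    rw [φ.left_inv h1]
    exact mdifferentiableAt_mul_left.hasMFDerivAt
  have hchart : HasMFDerivAt 𝓘(ℂ, E) 𝓘(ℂ, E) φ (φ.symm y * φ.symm (φ 1))
      (mfderiv 𝓘(ℂ, E) 𝓘(ℂ, E) φ (φ.symm y)) := by
    rw [φ.left_inv h1, mul_one]
    exact (hd.mdifferentiableAt (φ.map_target hy)).hasMFDerivAt
  have hcomp := (hchart.comp (φ 1) (hmul.comp (φ 1) hsymm)).hasFDerivAt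
  have hslice : HasFDerivAt (fun z : E => chartMul φ (y, z)) (leftChartFrame φ y) (φ 1) :=
    HasFDerivAt.comp (φ 1) (((contDiffAt_chartMul hφ h1 hy).restrict_scalars ℝ).differentiableAt
      (by simp)).hasFDerivAt (hasFDerivAt_prodMk_right y (φ 1))
  rw [leftFrame, hinv]
  exact DFunLike.congr_fun (hslice.unique (hcomp.restrictScalars ℝ)) w

omit [LieGroup 𝓘(ℂ, E) ω G] in
theorem leftFrame_chart_one (h1 : (1 : G) ∈ φ.source) :
    leftFrame φ (φ 1) =
      ContinuousLinearMap.inverse (mfderiv 𝓘(ℂ, E) 𝓘(ℂ, E) φ.symm (φ 1) : E →L[ℂ] E) := by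
  have hid : mfderiv 𝓘(ℂ, E) 𝓘(ℂ, E) (fun c : G => φ.symm (φ 1) * c) 1 = .id ℂ E := by
    have hfun : (fun c : G => φ.symm (φ 1) * c) = id := by
      ext c
      rw [φ.left_inv h1, one_mul, id]
    rw [hfun]
    exact mfderiv_id
  exact (congrArg _ hid).trans (ContinuousLinearMap.comp_id _)

variable [FiniteDimensional ℂ E]

theorem fderiv_leftChartFrame_apply (hφ : φ ∈ IsManifold.maximalAtlas 𝓘(ℂ, E) ω G)
    (h1 : (1 : G) ∈ φ.source) (v w : E) :
    fderiv ℝ (leftChartFrame φ) (φ 1) v w = fderiv ℂ (leftFrame φ) (φ 1) v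
      ((mfderiv 𝓘(ℂ, E) 𝓘(ℂ, E) φ.symm (φ 1) : E →L[ℂ] E) w) := by
  have hx : φ 1 ∈ φ.target := φ.map_source h1
  have hdiff : DifferentiableAt ℝ (leftChartFrame φ) (φ 1) :=
    (contDiffAt_leftChartFrame (((contDiffAt_chartMul hφ h1 hx).restrict_scalars ℝ).of_le
      le_top)).differentiableAt one_ne_zero
  have heq : (fun y => leftChartFrame φ y w) =ᶠ[𝓝 (φ 1)] fun y => leftFrame φ y
      ((mfderiv 𝓘(ℂ, E) 𝓘(ℂ, E) φ.symm (φ 1) : E →L[ℂ] E) w) := by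
    filter_upwards [φ.open_target.mem_nhds hx] with y hy using leftChartFrame_apply hφ h1 hy w
  exact DFunLike.congr_fun (((ContinuousLinearMap.apply ℝ E w).hasFDerivAt.comp (φ 1)
    hdiff.hasFDerivAt).unique (((hasFDerivAt_leftFrame_apply hφ hx _).restrictScalars
      ℝ).congr_of_eventuallyEq heq)) v

theorem exists_conj_groupLieBracket_eq (hφ : φ ∈ IsManifold.maximalAtlas 𝓘(ℂ, E) ω G)
    (h1 : (1 : G) ∈ φ.source) (u : E) : ∃ (j : E ≃ₗ[ℝ] E) (w : E),
      j.conj ((groupLieBracket E G).bilinearRestrictScalars ℝ u).toLinearMap =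
        (fderiv ℝ (leftChartFrame φ) (φ 1) w -
          (fderiv ℝ (leftChartFrame φ) (φ 1)).flip w).toLinearMap := by
  have hx : φ 1 ∈ φ.target := φ.map_source h1
  obtain ⟨j, hj⟩ : ∃ j : E ≃L[ℂ] E, (j : E →L[ℂ] E) = mfderiv 𝓘(ℂ, E) 𝓘(ℂ, E) φ.symm (φ 1) :=
    isInvertible_mfderiv_chart_symm hφ hx
  have hframe (v : E) : leftFrame φ (φ 1) v = j.symm v := by
    rw [leftFrame_chart_one h1, ← hj]
    exact DFunLike.congr_fun (ContinuousLinearMap.inverse_equiv j) v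
  have hchart (v : E) : (mfderiv 𝓘(ℂ, E) 𝓘(ℂ, E) φ.symm (φ 1) : E →L[ℂ] E) v = j v :=
    DFunLike.congr_fun hj.symm v
  refine ⟨j.symm.toLinearEquiv.restrictScalars ℝ, j.symm u, LinearMap.ext fun v => ?_⟩
  change j.symm (groupLieBracket E G u (j v)) =
    fderiv ℝ (leftChartFrame φ) (φ 1) (j.symm u) v - fderiv ℝ (leftChartFrame φ) (φ 1) v (j.symm u)
  rw [fderiv_leftChartFrame_apply hφ h1, fderiv_leftChartFrame_apply hφ h1, hchart, hchart,
    j.apply_symm_apply, ← hframe, ← fderiv_leftFrame_sub_swap hφ hx, hframe, hframe,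
    j.symm_apply_apply]

theorem isUnimodular_groupLieBracket (Γ : Subgroup G) [DiscreteTopology Γ]
    [CompactSpace (LeftQuotient Γ)] :
    Hermitian.IsUnimodular ((groupLieBracket E G).bilinearRestrictScalars ℝ) := by
  have : FiniteDimensional ℝ E := FiniteDimensional.complexToReal E
  have : IsTopologicalGroup G := topologicalGroup_of_lieGroup 𝓘(ℂ, E) ω
  have : T1Space G := 𝓘(ℂ, E).t1Space G
  have : LocallyCompactSpace G := ChartedSpace.locallyCompactSpace E G
  borelize G
  have := isMulRightInvariant_of_cocompact Γ (MeasureTheory.Measure.haar (G := G))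
  intro u
  have h1 : (1 : G) ∈ (chartAt E (1 : G)).source := mem_chart_source E 1
  have hφ := IsManifold.chart_mem_maximalAtlas (I := 𝓘(ℂ, E)) (n := ω) (1 : G)
  obtain ⟨j, w, hj⟩ := exists_conj_groupLieBracket_eq hφ h1 u
  rw [← LinearMap.trace_conj' _ j, hj]
  exact clmTrace_fderiv_leftChartFrame_eq_zero MeasureTheory.Measure.haar h1
    (((contDiffAt_chartMul hφ h1 (mem_chart_target E 1)).restrict_scalars ℝ).of_le le_top) w

end UnimodularLieAlgebra

section Pullback

variable {E : Type*} [NormedAddCommGroup E] [NormedSpace ℂ E]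
  {M : Type*} [TopologicalSpace M] [ChartedSpace E M]
  {N : Type*} [TopologicalSpace N] [ChartedSpace E N]
  {K : Type*} [TopologicalSpace K] [ChartedSpace E K]

theorem pullbackForm_congr {f f' : N → M} {x : N} (hf : f =ᶠ[𝓝 x] f')
    (b : E →L[ℝ] E →L[ℝ] ℝ) : pullbackForm E f x b = pullbackForm E f' x b :=
  congrArg (fun L : E →L[ℂ] E => b.bilinearComp (L.restrictScalars ℝ) (L.restrictScalars ℝ))
    hf.mfderiv_eq

theorem pullbackForm_comp {f : N → M} {k : K → N} {x : K}
    (hf : MDifferentiableAt 𝓘(ℂ, E) 𝓘(ℂ, E) f (k x))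
    (hk : MDifferentiableAt 𝓘(ℂ, E) 𝓘(ℂ, E) k x) (b : E →L[ℝ] E →L[ℝ] ℝ) :
    pullbackForm E (f ∘ k) x b = pullbackForm E k x (pullbackForm E f (k x) b) := by
  have hchain : (mfderiv 𝓘(ℂ, E) 𝓘(ℂ, E) (f ∘ k) x : E →L[ℂ] E) =
      (mfderiv 𝓘(ℂ, E) 𝓘(ℂ, E) f (k x) : E →L[ℂ] E).comp
        (mfderiv 𝓘(ℂ, E) 𝓘(ℂ, E) k x : E →L[ℂ] E) := mfderiv_comp x hf hk
  rw [pullbackForm, hchain]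
  rfl

theorem exists_equiv_pullbackForm_apply {f : N → M} {x : N}
    (hf : (mfderiv 𝓘(ℂ, E) 𝓘(ℂ, E) f x : E →L[ℂ] E).IsInvertible) :
    ∃ e : E ≃L[ℂ] E, ∀ b u v, pullbackForm E f x b u v = b (e u) (e v) := by
  obtain ⟨e, he⟩ : ∃ e : E ≃L[ℂ] E, (e : E →L[ℂ] E) = mfderiv 𝓘(ℂ, E) 𝓘(ℂ, E) f x := hf
  refine ⟨e, fun b u v => ?_⟩
  rw [pullbackForm, ← he]
  rfl

theorem pullbackForm_bijective {f : N → M} {x : N}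
    (hf : (mfderiv 𝓘(ℂ, E) 𝓘(ℂ, E) f x : E →L[ℂ] E).IsInvertible) :
    Function.Bijective (pullbackForm E f x) := by
  obtain ⟨e, he⟩ := exists_equiv_pullbackForm_apply hf
  refine Function.bijective_iff_has_inverse.2 ⟨fun b => b.bilinearComp
    ((e.symm : E →L[ℂ] E).restrictScalars ℝ) ((e.symm : E →L[ℂ] E).restrictScalars ℝ),
    fun b => ?_, fun b => ?_⟩ <;> ext u v <;> simp [he]

theorem isHermitianForm_of_pullbackForm {f : N → M} {x : N}
    (hf : (mfderiv 𝓘(ℂ, E) 𝓘(ℂ, E) f x : E →L[ℂ] E).IsInvertible) {b : E →L[ℝ] E →L[ℝ] ℝ}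
    (hb : Hermitian.IsHermitianForm (pullbackForm E f x b)) : Hermitian.IsHermitianForm b := by
  obtain ⟨e, he⟩ := exists_equiv_pullbackForm_apply hf
  convert hb.bilinearComp (Q := (e.symm : E →L[ℂ] E).restrictScalars ℝ) e.symm.injective
    (e.symm.map_smul Complex.I)
  ext u v
  simp [he]

end Pullback

namespace HermitianMetric

open Hermitian

variable {E : Type*} [NormedAddCommGroup E] [NormedSpace ℂ E]

theorem isHermitianForm_inner {M : Type*} [TopologicalSpace M] [ChartedSpace E M]
    (h : HermitianMetric E M) (x : M) : IsHermitianForm (h.inner x) :=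
  ⟨h.symm x, h.pos x, h.hermitian x⟩

variable {G : Type*} [Group G] [TopologicalSpace G] [ChartedSpace E G] [LieGroup 𝓘(ℂ, E) ω G]

omit [LieGroup 𝓘(ℂ, E) ω G] in
theorem IsLeftInvariant.inChart_leftFrame [IsManifold 𝓘(ℂ, E) ω G] {g : HermitianMetric E G}
    (hg : g.IsLeftInvariant) {ε : OpenPartialHomeomorph G E}
    (hε : ε ∈ IsManifold.maximalAtlas 𝓘(ℂ, E) ω G) {y : E} (hy : y ∈ ε.target) (u v : E) :
    g.inChart ε y (leftFrame ε y u) (leftFrame ε y v) = g.inner 1 u v := by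
  have hframe (w : E) : (mfderiv 𝓘(ℂ, E) 𝓘(ℂ, E) ε.symm y : E →L[ℂ] E) (leftFrame ε y w) =
      (mfderiv 𝓘(ℂ, E) 𝓘(ℂ, E) (fun c : G => ε.symm y * c) 1 : E →L[ℂ] E) w :=
    (isInvertible_mfderiv_chart_symm hε hy).self_apply_inverse _
  have htranslate := hg (ε.symm y) 1
  rw [mul_one] at htranslate
  rw [← htranslate]
  exact congrArg₂ (fun a b : E => g.inner (ε.symm y) a b) (hframe u) (hframe v)

variable [FiniteDimensional ℂ E]

theorem IsLeftInvariant.isMaurerCartanAt {g : HermitianMetric E G} (hg : g.IsLeftInvariant)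
    {ε : OpenPartialHomeomorph G E} (hε : ε ∈ IsManifold.maximalAtlas 𝓘(ℂ, E) ω G) {y : E}
    (hy : y ∈ ε.target) :
    IsMaurerCartanAt (g.inChart ε) (g.inner 1) ((groupLieBracket E G).bilinearRestrictScalars ℝ)
      (maurerCartanForm ε) y where
  contDiffAt := contDiffAt_maurerCartanForm hε hy
  isInvertible := isInvertible_maurerCartanForm hε hy
  map_J := .of_forall fun z => map_smul (ContinuousLinearMap.inverse (leftFrame ε z)) Complex.I
  metric := by
    filter_upwards [ε.open_target.mem_nhds hy] with z hz
    ext u v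
    rw [ContinuousLinearMap.bilinearComp_apply, ← hg.inChart_leftFrame hε hz,
      leftFrame_maurerCartanForm hε hz, leftFrame_maurerCartanForm hε hz]
  maurerCartan := fderiv_maurerCartanForm_sub_swap hε hy

end HermitianMetric

namespace LeftQuotient

variable {E : Type*} [NormedAddCommGroup E] [NormedSpace ℂ E]
  {G : Type*} [Group G] {Γ : Subgroup G}

theorem proj_surjective : Function.Surjective (proj Γ) :=
  Quotient.mk_surjective

variable [TopologicalSpace G] [ChartedSpace E G] [LieGroup 𝓘(ℂ, E) ω G] [DiscreteTopology Γ]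

theorem mdifferentiableAt_proj (a : G) : MDifferentiableAt 𝓘(ℂ, E) 𝓘(ℂ, E) (proj Γ) a :=
  (isLocalDiffeomorph_proj Γ).contMDiff.contMDiffAt.mdifferentiableAt (by simp)

theorem isInvertible_mfderiv_proj (a : G) :
    (mfderiv 𝓘(ℂ, E) 𝓘(ℂ, E) (proj Γ) a : E →L[ℂ] E).IsInvertible :=
  ⟨(isLocalDiffeomorph_proj Γ).mfderivToContinuousLinearEquiv (by simp) a, rfl⟩

theorem exists_lift_chart {e : OpenPartialHomeomorph (LeftQuotient Γ) E}
    (he : e ∈ IsManifold.maximalAtlas 𝓘(ℂ, E) ω (LeftQuotient Γ)) {y : E} (hy : y ∈ e.target) :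
    ∃ ε ∈ IsManifold.maximalAtlas 𝓘(ℂ, E) ω G, y ∈ ε.target ∧
      ∀ z ∈ ε.target, e.symm z = proj Γ (ε.symm z) := by
  obtain ⟨a, ha⟩ := proj_surjective (e.symm y)
  obtain ⟨Φ, haΦ, hΦ⟩ := isLocalDiffeomorph_proj (E := E) Γ a
  let ψ := Φ.toOpenPartialHomeomorph
  have hψ : ∀ b ∈ ψ.source, proj Γ b = ψ b := hΦ
  refine ⟨ψ.trans e, ?_, ⟨hy, ?_⟩, fun z hz => ?_⟩
  · apply OpenPartialHomeomorph.mem_maximalAtlas_of_contMDiffOn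
    · exact (contMDiffOn_of_mem_maximalAtlas he).comp
        (Φ.contMDiffOn_toFun.mono fun b hb => hb.1) fun b hb => hb.2
    · exact Φ.contMDiffOn_invFun.comp
        ((contMDiffOn_symm_of_mem_maximalAtlas he).mono fun b hb => hb.1) fun b hb => hb.2
  · change e.symm y ∈ ψ.target
    rw [← ha, hψ a haΦ]
    exact ψ.map_source haΦ
  · change e.symm z = proj Γ (ψ.symm (e.symm z))
    rw [hψ _ (ψ.map_target hz.2), ψ.right_inv hz.2]

theorem pullbackForm_chart_symm {e : OpenPartialHomeomorph (LeftQuotient Γ) E}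
    {ε : OpenPartialHomeomorph G E} (hε : ε ∈ IsManifold.maximalAtlas 𝓘(ℂ, E) ω G)
    (he : ∀ z ∈ ε.target, e.symm z = proj Γ (ε.symm z)) {y : E} (hy : y ∈ ε.target)
    (b : E →L[ℝ] E →L[ℝ] ℝ) :
    pullbackForm E e.symm y b =
      pullbackForm E ε.symm y (pullbackForm E (proj Γ) (ε.symm y) b) := by
  have heq : e.symm =ᶠ[𝓝 y] proj Γ ∘ ε.symm := by
    filter_upwards [ε.open_target.mem_nhds hy] with z hz using he z hz
  rw [pullbackForm_congr heq, pullbackForm_comp (mdifferentiableAt_proj _)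
    ((mdifferentiable_of_mem_maximalAtlas hε).mdifferentiableAt_symm hy)]

theorem exists_pullbackForm_proj_eq {g : HermitianMetric E G} (hg : g.IsLeftInvariant)
    (x : LeftQuotient Γ) :
    ∃ b : E →L[ℝ] E →L[ℝ] ℝ, ∀ a : G, proj Γ a = x → pullbackForm E (proj Γ) a b = g.inner a := by
  obtain ⟨o, ho⟩ := proj_surjective x
  obtain ⟨b, hb⟩ := (pullbackForm_bijective (isInvertible_mfderiv_proj (Γ := Γ) o)).2 (g.inner o)
  refine ⟨b, fun a ha => ?_⟩
  obtain ⟨γ, hγ, rfl⟩ : ∃ γ ∈ Γ, a = γ * o :=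
    ⟨a * o⁻¹, proj_eq_iff.1 (ho.trans ha.symm), (inv_mul_cancel_right a o).symm⟩
  apply (pullbackForm_bijective (isInvertible_mfderiv_mul_left γ o)).1
  have hproj : proj Γ ∘ (fun c => γ * c) = proj Γ :=
    funext fun c => proj_eq_iff.2 (by simpa using hγ)
  rw [hg γ o, ← hb, ← pullbackForm_comp (k := fun c : G => γ * c) (mdifferentiableAt_proj _)
    mdifferentiableAt_mul_left, hproj]

theorem exists_isInducedBy {g : HermitianMetric E G} (hg : g.IsLeftInvariant) :
    ∃ h : HermitianMetric E (LeftQuotient Γ), h.IsInducedBy g := by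
  choose b hb using exists_pullbackForm_proj_eq (Γ := Γ) hg
  have hherm (x : LeftQuotient Γ) : Hermitian.IsHermitianForm (b x) := by
    obtain ⟨a, rfl⟩ := proj_surjective x
    exact isHermitianForm_of_pullbackForm (isInvertible_mfderiv_proj a)
      (hb _ a rfl ▸ g.isHermitianForm_inner a)
  refine ⟨⟨b, fun x => (hherm x).symm, fun x => (hherm x).pos, fun x => (hherm x).hermitian,
    fun e he y hy => ?_⟩, fun a => hb _ a rfl⟩
  obtain ⟨ε, hε, hyε, hlift⟩ := exists_lift_chart he hy
  refine (((g.smooth ε hε).contDiffAt (ε.open_target.mem_nhds hyε)).congr_of_eventuallyEq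
    ?_).contDiffWithinAt
  filter_upwards [ε.open_target.mem_nhds hyε] with z hz
  rw [pullbackForm_chart_symm hε hlift hz, hb _ _ (hlift z hz).symm]

end LeftQuotient

namespace HermitianMetric.IsInducedBy

open Hermitian

variable {E : Type*} [NormedAddCommGroup E] [NormedSpace ℂ E]
  {G : Type*} [Group G] [TopologicalSpace G] [ChartedSpace E G] [LieGroup 𝓘(ℂ, E) ω G]
  {Γ : Subgroup G} [DiscreteTopology Γ] {h h' : HermitianMetric E (LeftQuotient Γ)}
  {g : HermitianMetric E G}

theorem eq (hh : h.IsInducedBy g) (hh' : h'.IsInducedBy g) : h = h' := by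
  ext1
  funext x
  obtain ⟨a, rfl⟩ := LeftQuotient.proj_surjective x
  exact (pullbackForm_bijective (LeftQuotient.isInvertible_mfderiv_proj a)).1
    ((hh a).trans (hh' a).symm)

theorem inChart_eq (hh : h.IsInducedBy g) {e : OpenPartialHomeomorph (LeftQuotient Γ) E}
    {ε : OpenPartialHomeomorph G E} (hε : ε ∈ IsManifold.maximalAtlas 𝓘(ℂ, E) ω G)
    (he : ∀ z ∈ ε.target, e.symm z = LeftQuotient.proj Γ (ε.symm z)) {y : E}
    (hy : y ∈ ε.target) : h.inChart e y = g.inChart ε y := by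
  rw [inChart, inChart, LeftQuotient.pullbackForm_chart_symm hε he hy, he y hy, hh]

variable [FiniteDimensional ℂ E]

theorem exists_isMaurerCartanAt (hh : h.IsInducedBy g) (hg : g.IsLeftInvariant)
    {e : OpenPartialHomeomorph (LeftQuotient Γ) E}
    (he : e ∈ IsManifold.maximalAtlas 𝓘(ℂ, E) ω (LeftQuotient Γ)) {y : E} (hy : y ∈ e.target) :
    ∃ P, ∀ᶠ z in 𝓝 y, IsMaurerCartanAt (h.inChart e) (g.inner 1)
      ((groupLieBracket E G).bilinearRestrictScalars ℝ) P z := by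
  obtain ⟨ε, hε, hyε, hlift⟩ := LeftQuotient.exists_lift_chart he hy
  refine ⟨maurerCartanForm ε, ?_⟩
  filter_upwards [ε.open_target.mem_nhds hyε] with z hz
  refine { hg.isMaurerCartanAt hε hz with metric := ?_ }
  filter_upwards [(hg.isMaurerCartanAt hε hz).metric, ε.open_target.mem_nhds hz] with w hw hwε
  rwa [hh.inChart_eq hε hlift hwε]

variable [CompactSpace (LeftQuotient Γ)]

theorem isBalanced (hh : h.IsInducedBy g) (hg : g.IsLeftInvariant) : h.IsBalanced := by
  intro e he y hy b hb Y
  have : FiniteDimensional ℝ E := FiniteDimensional.complexToReal E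
  obtain ⟨P, hP⟩ := hh.exists_isMaurerCartanAt hg he hy
  exact hP.self_of_nhds.codiffKahler_eq_zero (g.isHermitianForm_inner 1)
    (isComplexBracket_groupLieBracket E G) (isUnimodular_groupLieBracket Γ) hb Y

theorem ricciFormVanishes (hh : h.IsInducedBy g) (hg : g.IsLeftInvariant) (t : ℝ) :
    h.RicciFormVanishes t := by
  intro e he y hy b hb X Y
  have : FiniteDimensional ℝ E := FiniteDimensional.complexToReal E
  obtain ⟨P, hP⟩ := hh.exists_isMaurerCartanAt hg he hy
  exact ricciForm_eq_zero hP (g.isHermitianForm_inner 1) (isComplexBracket_groupLieBracket E G)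
    (isUnimodular_groupLieBracket Γ) t hb X Y

end HermitianMetric.IsInducedBy

end

theorem mainTheorem8 {E : Type*} [NormedAddCommGroup E] [NormedSpace ℂ E] [FiniteDimensional ℂ E]
    {G : Type*} [Group G] [TopologicalSpace G] [ChartedSpace E G] [LieGroup 𝓘(ℂ, E) ω G]
    (Γ : Subgroup G) [DiscreteTopology Γ] [CompactSpace (LeftQuotient Γ)]
    (g : HermitianMetric E G) (hg : g.IsLeftInvariant) :
    (∃! h : HermitianMetric E (LeftQuotient Γ), h.IsInducedBy g) ∧
      ∀ h : HermitianMetric E (LeftQuotient Γ), h.IsInducedBy g →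
        h.IsBalanced ∧ h.IsCYT ∧ ∀ t : ℝ, h.RicciFormVanishes t := by
  obtain ⟨h, hh⟩ := LeftQuotient.exists_isInducedBy (Γ := Γ) hg
  exact ⟨⟨h, hh, fun h' hh' => hh'.eq hh⟩, fun k hk =>
    ⟨hk.isBalanced hg, hk.ricciFormVanishes hg (-1), hk.ricciFormVanishes hg⟩⟩
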